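/- Let $\mathcal{O}=\mathbb{C}\{x,y\}$ be the ring of convergent power series in two variables and $\mathfrak{m}=\langle x,y\rangle$ its maximal ideal. For $g\in\mathcal{O}$ let $\mathrm{Der}_g$ be the $\mathcal{O}$-module of logarithmic derivations for $g$, that is, of $\mathbb{C}$-derivations $\delta$ of $\mathcal{O}$ with $\delta(g)\in\langle g\rangle$. The linear part of a derivation $\delta=\alpha\,\partial_x+\beta\,\partial_y$ is $\delta_0=\alpha_1\partial_x+\beta_1\partial_y$, where $\alpha_1,\beta_1$ are the homogeneous components of degree one of $\alpha,\beta\in\mathcal{O}$. Let $f\in\mathfrak{m}^3$ be reduced (that is, without repeated factors), so that $f$ is a reduced local equation at $0$ of a plane curve. Then: (i) After no change of variables does $\mathrm{Der}_f$ have a basis whose elements have linear parts $x\partial_x$ and $(ax+y)\partial_x$ with $a\in\mathbb{C}$. That is, for every automorphism $\varphi$ of the $\mathbb{C}$-algebra $\mathcal{O}$ and every $a\in\mathbb{C}$, there is no basis $\{\delta_1,\delta_2\}$ of the $\mathcal{O}$-module $\mathrm{Der}_{\varphi(f)}$ such that $\delta_1$ has linear part $x\partial_x$ and $\delta_2$ has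 linear part $(ax+y)\partial_x$. (ii) There is a basis $\{\delta_1,\delta_2\}$ of the $\mathcal{O}$-module $\mathrm{Der}_f$ such that $\delta_1$ has zero linear part. -/

import Mathlib

noncomputable section

namespace ConvSeries

/-- A formal power series in `n` variables over `ℂ` is convergent if it converges absolutely on
some polydisc of positive radius about the origin. -/
def IsConvergent {n : ℕ} (f : MvPowerSeries (Fin n) ℂ) : Prop :=
  ∃ r : ℝ, 0 < r ∧ Summable fun k : Fin n →₀ ℕ => ‖MvPowerSeries.coeff k f‖ * r ^ k.degree

theorem summable_of_le {n : ℕ} {h : MvPowerSeries (Fin n) ℂ} {p q : ℝ} (hp : 0 < p) (hpq : p ≤ q)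
    (hq : Summable fun k : Fin n →₀ ℕ => ‖MvPowerSeries.coeff k h‖ * q ^ k.degree) :
    Summable fun k : Fin n →₀ ℕ => ‖MvPowerSeries.coeff k h‖ * p ^ k.degree := by
  refine Summable.of_nonneg_of_le (fun k => by positivity) (fun k => ?_) hq
  gcongr

theorem IsConvergent.mul {n : ℕ} {f g : MvPowerSeries (Fin n) ℂ} (hf : IsConvergent f)
    (hg : IsConvergent g) : IsConvergent (f * g) := by
  obtain ⟨r, hr, hf⟩ := hf
  obtain ⟨s, hs, hg⟩ := hg
  have ht : 0 < min r s := lt_min hr hs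
  refine ⟨min r s, ht, ?_⟩
  generalize htt : min r s = t at ht
  have hf' := summable_of_le ht (htt ▸ min_le_left r s) hf
  have hg' := summable_of_le ht (htt ▸ min_le_right r s) hg
  set F : (Fin n →₀ ℕ) → ℝ := fun k => ‖MvPowerSeries.coeff k f‖ * t ^ k.degree with hF
  set G : (Fin n →₀ ℕ) → ℝ := fun k => ‖MvPowerSeries.coeff k g‖ * t ^ k.degree with hG
  have hF0 : 0 ≤ F := fun k => mul_nonneg (norm_nonneg _) (pow_nonneg ht.le _)
  have hG0 : 0 ≤ G := fun k => mul_nonneg (norm_nonneg _) (pow_nonneg ht.le _)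
  have hFG : Summable fun x : (Fin n →₀ ℕ) × (Fin n →₀ ℕ) => F x.1 * G x.2 :=
    Summable.mul_of_nonneg hf' hg' hF0 hG0
  have key : Summable fun k => ∑ p ∈ Finset.HasAntidiagonal.antidiagonal k, F p.1 * G p.2 :=
    summable_sum_mul_antidiagonal_of_summable_mul hFG
  refine Summable.of_nonneg_of_le (fun k => by positivity) (fun k => ?_) key
  rw [MvPowerSeries.coeff_mul]
  refine (mul_le_mul_of_nonneg_right (norm_sum_le _ _) (by positivity)).trans ?_
  rw [Finset.sum_mul]
  refine Finset.sum_le_sum fun p hp => le_of_eq ?_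
  simp only [hF, hG]
  rw [← Finset.HasAntidiagonal.mem_antidiagonal.mp hp, map_add, pow_add, norm_mul]
  ring

theorem IsConvergent.add {n : ℕ} {f g : MvPowerSeries (Fin n) ℂ} (hf : IsConvergent f)
    (hg : IsConvergent g) : IsConvergent (f + g) := by
  obtain ⟨r, hr, hf⟩ := hf
  obtain ⟨s, hs, hg⟩ := hg
  have ht : 0 < min r s := lt_min hr hs
  refine ⟨min r s, ht, ?_⟩
  generalize htt : min r s = t at ht
  have hf' := summable_of_le ht (htt ▸ min_le_left r s) hf
  have hg' := summable_of_le ht (htt ▸ min_le_right r s) hg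
  refine Summable.of_nonneg_of_le (fun k => by positivity) (fun k => ?_) (hf'.add hg')
  rw [map_add, ← add_mul]
  gcongr
  exact norm_add_le _ _

theorem isConvergent_algebraMap {n : ℕ} (c : ℂ) :
    IsConvergent (algebraMap ℂ (MvPowerSeries (Fin n) ℂ) c) := by
  refine ⟨1, one_pos, summable_of_ne_finset_zero (s := {0}) fun k hk => ?_⟩
  have hk0 : k ≠ 0 := by simpa using hk
  classical
  rw [MvPowerSeries.algebraMap_apply, MvPowerSeries.coeff_C, if_neg hk0]
  simp

theorem isConvergent_X {n : ℕ} (i : Fin n) :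
    IsConvergent (MvPowerSeries.X i : MvPowerSeries (Fin n) ℂ) := by
  refine ⟨1, one_pos, summable_of_ne_finset_zero (s := {Finsupp.single i 1}) fun k hk => ?_⟩
  have hk0 : k ≠ Finsupp.single i 1 := by simpa using hk
  classical
  rw [MvPowerSeries.coeff_X, if_neg hk0]
  simp

/-- The algebra `ℂ{x₁, …, xₙ}` of convergent power series. -/
def convergentPowerSeries (n : ℕ) : Subalgebra ℂ (MvPowerSeries (Fin n) ℂ) where
  carrier := {f | IsConvergent f}
  mul_mem' := IsConvergent.mul
  add_mem' := IsConvergent.add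
  algebraMap_mem' := isConvergent_algebraMap

/-- The local ring `𝒪 = ℂ{x₁, …, xₙ}`. -/
abbrev O (n : ℕ) : Type := ↥(convergentPowerSeries n)

variable {n : ℕ}

/-- The coordinate function `xᵢ`. -/
def X (i : Fin n) : O n := ⟨MvPowerSeries.X i, isConvergent_X i⟩

/-- The maximal ideal `𝔪 = ⟨x₁, …, xₙ⟩`. -/
def maxIdeal (n : ℕ) : Ideal (O n) := Ideal.span (Set.range X)

theorem IsConvergent.pderiv (i : Fin n) {f : MvPowerSeries (Fin n) ℂ} (hf : IsConvergent f) :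
    IsConvergent (MvPowerSeries.pderiv ℂ i f) := by
  obtain ⟨r, hr, hf⟩ := hf
  refine ⟨r / 2, by positivity, ?_⟩
  have h1 := (hf.comp_injective (add_left_injective (Finsupp.single i 1))).mul_right r⁻¹
  refine Summable.of_nonneg_of_le (fun k => by positivity) (fun k => ?_) h1
  rw [MvPowerSeries.coeff_pderiv, norm_mul]
  have h2 : ‖((k i : ℂ) + 1)‖ ≤ (2 : ℝ) ^ k.degree := by
    have h3 : k i + 1 ≤ 2 ^ k.degree :=
      (Nat.lt_two_pow_self (n := k i)).trans_le
        (Nat.pow_le_pow_right (by norm_num) (Finsupp.le_degree i k))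
    have h4 : ‖((k i : ℂ) + 1)‖ = ((k i + 1 : ℕ) : ℝ) := by
      rw [← Complex.norm_natCast]
      push_cast
      rfl
    rw [h4]
    exact_mod_cast h3
  have h5 : (k + Finsupp.single i 1).degree = k.degree + 1 := by simp
  simp only [Function.comp_apply]
  rw [h5, div_pow, pow_succ]
  have h6 : (0 : ℝ) < 2 ^ k.degree := by positivity
  calc ‖MvPowerSeries.coeff (k + Finsupp.single i 1) f‖ * ‖((k i : ℂ) + 1)‖
        * (r ^ k.degree / 2 ^ k.degree)
      ≤ ‖MvPowerSeries.coeff (k + Finsupp.single i 1) f‖ * 2 ^ k.degree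
        * (r ^ k.degree / 2 ^ k.degree) := by gcongr
    _ = _ := by field_simp

/-- The partial derivative `∂ᵢ = ∂/∂xᵢ`, a `ℂ`-derivation of `𝒪`. -/
def partialDer (i : Fin n) : Derivation ℂ (O n) (O n) :=
  Derivation.mk'
    { toFun := fun f => ⟨MvPowerSeries.pderiv ℂ i f.1, IsConvergent.pderiv i f.2⟩
      map_add' := fun f g => Subtype.ext (by simp)
      map_smul' := fun c f => Subtype.ext (by simp) }
    (fun f g => Subtype.ext (by simp [Derivation.leibniz]))

/-- The homogeneous component of degree one of a convergent power series. -/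
def linearComponent (g : O n) : O n :=
  ∑ i, MvPowerSeries.coeff (Finsupp.single i 1) (g : MvPowerSeries (Fin n) ℂ) • X i

/-- The linear part `δ₀` of a derivation `δ = ∑ⱼ δ(xⱼ) ∂ⱼ`: every coefficient `δ(xⱼ)` is replaced
by its homogeneous component of degree one. -/
def linearPart (δ : Derivation ℂ (O n) (O n)) : Derivation ℂ (O n) (O n) :=
  ∑ j, linearComponent (δ (X j)) • partialDer j

/-- The `𝒪`-module `Der_f` of logarithmic derivations for `f`: the `ℂ`-derivations `δ` of `𝒪`
with `δ(f) ∈ ⟨f⟩`. -/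
def logDer (f : O n) : Submodule (O n) (Derivation ℂ (O n) (O n)) where
  carrier := {δ | δ f ∈ Ideal.span {f}}
  add_mem' := fun {a b} ha hb => by
    simpa using Ideal.add_mem _ (show a f ∈ Ideal.span {f} from ha) hb
  zero_mem' := by simp
  smul_mem' := fun c a ha => by
    simpa using Ideal.mul_mem_left (Ideal.span {f}) c ha



end ConvSeries

end

/-!
Write `𝒪 = ℂ{x, y}` and `𝔪` for its maximal ideal.

*The ring.* Weierstrass division (`exists_weierstrass_division`) shows that every prime ideal of `𝒪`
is principal or equal to `𝔪` (`isPrincipal_or_eq_maxIdeal`). Hence `𝒪` is a Noetherian factorial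
local ring, and `𝒪 / x` is a principal ideal domain.

*Saito's theory.* For reduced `f` the Tjurina ideal `J = ⟨f, f_x, f_y⟩` is contained in no principal
prime ideal, so it contains a power of each coordinate; it is stable under `Der_f`, which forces the
logarithmic derivations to vanish at the origin when `J ⊆ 𝔪` (`constCoeff_eq_zero_of_mem_logDer`).
The module `Der_f` is free of rank two, because `Der_f / x Der_f` is torsion-free over `𝒪 / x`
(`nonempty_basis_logDer`), and the determinant of a basis is a unit multiple of `f`
(`exists_unit_derDet_eq`).

*The excluded linear parts.* Suppose that a basis `δ, η` of `Der_f` has linear parts `ℓ ∂ᵥ` and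
`ℓ' ∂ᵥ` with `ℓ, ℓ'` independent and, after exchanging and scaling, `ℓ(v) = 1`. Differentiating
`det(δ, η) = f u` along `δ` gives `δ(f) = f h` with `h(0) = tr [δ, ·](0) + (div δ)(0) = -1 + 1 = 0`.
The linear part of `δ` has eigenvalues `1` and `0`, so there is a formal integral curve `γ` tangent
to `v` with `t d/dt ∘ γ = γ ∘ δ`, up to any prescribed order. Comparing coefficients in this
relation for `f`, `f_x` and `f_y`, and using `h(0) = 0`, one finds that all three vanish along `γ`,
so that `J` vanishes on a curve. This contradicts the presence of powers of the coordinates in `J`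
(`constCoeff_ne_zero_of_linCoeff_eq`, `not_linCoeff_basis_eq`). The first claim is the case
`v = (1, 0)`, applied to `φ(f)`.

*A basis element without linear part.* Since the determinant of a basis lies in `⟨f⟩ ⊆ 𝔪³`, the
determinant of the two linear parts vanishes. Two vectors of linear forms with vanishing determinant
are either linearly dependent over `ℂ`, in which case a change of basis removes one of them, or
multiples of a common vector `v` by independent forms, which has just been excluded
(`linearForms_of_det_eq_zero`).
-/

noncomputable section

namespace ConvSeries

/-! ### Weierstrass division for convergent power series in two variables -/

open MvPowerSeries in
/-- The norm `∑ₚ |fₚ| ρ ^ w(p)` of a formal power series, for weights `w` on the exponents. -/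
def weightedNorm (w : (Fin 2 →₀ ℕ) →+ ℕ) (ρ : ENNReal) (f : MvPowerSeries (Fin 2) ℂ) : ENNReal :=
  ∑' p, ‖coeff p f‖ₑ * ρ ^ w p

/-- The weight on exponents for which `x` has weight `k + 1` and `y` has weight `1`. It is chosen
so that every monomial `xᵃyᵇ` other than `1, y, …, yᵏ` has weight at least `k + 1`. -/
def yWeight (k : ℕ) : (Fin 2 →₀ ℕ) →+ ℕ :=
  (k + 1) • Finsupp.applyAddHom 0 + Finsupp.applyAddHom 1

theorem yWeight_apply (k : ℕ) (p : Fin 2 →₀ ℕ) : yWeight k p = (k + 1) * p 0 + p 1 := by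
  simp [yWeight]

theorem degree_fin_two (p : Fin 2 →₀ ℕ) : p.degree = p 0 + p 1 := by
  simp [Finsupp.degree_eq_sum, Fin.sum_univ_two]

theorem weightedNorm_add_le (w : (Fin 2 →₀ ℕ) →+ ℕ) (ρ : ENNReal) (f g : MvPowerSeries (Fin 2) ℂ) :
    weightedNorm w ρ (f + g) ≤ weightedNorm w ρ f + weightedNorm w ρ g := by
  rw [weightedNorm, weightedNorm, weightedNorm, ← ENNReal.tsum_add]
  refine ENNReal.tsum_le_tsum fun p => ?_
  rw [← add_mul, map_add]
  gcongr
  exact enorm_add_le _ _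

theorem weightedNorm_neg (w : (Fin 2 →₀ ℕ) →+ ℕ) (ρ : ENNReal) (f : MvPowerSeries (Fin 2) ℂ) :
    weightedNorm w ρ (-f) = weightedNorm w ρ f := by
  simp [weightedNorm]

theorem weightedNorm_mul_le (w : (Fin 2 →₀ ℕ) →+ ℕ) (ρ : ENNReal) (f g : MvPowerSeries (Fin 2) ℂ) :
    weightedNorm w ρ (f * g) ≤ weightedNorm w ρ f * weightedNorm w ρ g := by
  set F : (Fin 2 →₀ ℕ) → ENNReal := fun p => ‖MvPowerSeries.coeff p f‖ₑ * ρ ^ w p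
  set G : (Fin 2 →₀ ℕ) → ENNReal := fun p => ‖MvPowerSeries.coeff p g‖ₑ * ρ ^ w p
  have h1 : weightedNorm w ρ f * weightedNorm w ρ g
      = ∑' n, ∑ p ∈ Finset.HasAntidiagonal.antidiagonal n, F p.1 * G p.2 := by
    calc weightedNorm w ρ f * weightedNorm w ρ g
        = ∑' a, ∑' b, F a * G b := by
          rw [weightedNorm, weightedNorm, ← ENNReal.tsum_mul_right]
          simp_rw [← ENNReal.tsum_mul_left]; rfl
      _ = ∑' x : (Fin 2 →₀ ℕ) × (Fin 2 →₀ ℕ), F x.1 * G x.2 := by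
          rw [← ENNReal.tsum_prod]
      _ = _ := by
          rw [← Finset.HasAntidiagonal.sigmaAntidiagonalEquivProd.tsum_eq, ENNReal.tsum_sigma']
          refine tsum_congr fun n => ?_
          rw [tsum_fintype]
          exact Finset.sum_coe_sort (Finset.HasAntidiagonal.antidiagonal n) fun p => F p.1 * G p.2
  rw [h1]
  refine ENNReal.tsum_le_tsum fun n => ?_
  rw [MvPowerSeries.coeff_mul]
  refine (mul_le_mul_left (enorm_sum_le _ _) _).trans ?_
  rw [Finset.sum_mul]
  refine Finset.sum_le_sum fun p hp => le_of_eq ?_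
  simp only [F, G]
  rw [← Finset.HasAntidiagonal.mem_antidiagonal.mp hp, map_add, pow_add, enorm_mul]
  ring

theorem IsConvergent.exists_weightedNorm_ne_top {f g : MvPowerSeries (Fin 2) ℂ}
    (hf : IsConvergent f) (hg : IsConvergent g) (k : ℕ) :
    ∃ ρ : NNReal, 0 < ρ ∧ ρ ≤ 1 ∧ weightedNorm (yWeight k) ρ f ≠ ⊤ ∧
      weightedNorm (yWeight k) ρ g ≠ ⊤ := by
  obtain ⟨r, hr, hf⟩ := hf
  obtain ⟨s, hs, hg⟩ := hg
  let ρ : ℝ := min (min r s) 1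
  have hρ : 0 < ρ := by positivity
  have key : ∀ {h : MvPowerSeries (Fin 2) ℂ} {q : ℝ}, ρ ≤ q →
      (Summable fun k : Fin 2 →₀ ℕ => ‖MvPowerSeries.coeff k h‖ * q ^ k.degree) →
      weightedNorm (yWeight k) (ρ.toNNReal : ENNReal) h ≠ ⊤ := by
    intro h q hq hs
    have h1 := (summable_of_le hρ hq hs).tsum_ofReal_ne_top
    refine ne_top_of_le_ne_top h1 (ENNReal.tsum_le_tsum fun p => ?_)
    rw [ENNReal.ofReal_mul (norm_nonneg _), ofReal_norm, ENNReal.ofReal_pow hρ.le]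
    change _ * ENNReal.ofReal ρ ^ _ ≤ _
    refine mul_le_mul' le_rfl ?_
    refine pow_le_pow_of_le_one (a := ENNReal.ofReal ρ) zero_le
      (ENNReal.ofReal_le_one.2 (min_le_right _ _)) ?_
    rw [yWeight_apply, degree_fin_two]; nlinarith
  refine ⟨ρ.toNNReal, by simpa using hρ, Real.toNNReal_le_one.2 (min_le_right _ _), ?_, ?_⟩
  · exact key ((min_le_left _ _).trans (min_le_left _ _)) hf
  · exact key ((min_le_left _ _).trans (min_le_right _ _)) hg

theorem isConvergent_of_weightedNorm_ne_top {f : MvPowerSeries (Fin 2) ℂ} {k : ℕ} {ρ : NNReal}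
    (hρ : 0 < ρ) (hρ1 : ρ ≤ 1) (h : weightedNorm (yWeight k) ρ f ≠ ⊤) : IsConvergent f := by
  refine ⟨(ρ : ℝ) ^ (k + 1), by positivity, ?_⟩
  have h1 : Summable fun p => ‖MvPowerSeries.coeff p f‖ * (ρ : ℝ) ^ yWeight k p := by
    have h2 := ENNReal.summable_toReal h
    refine h2.congr fun p => ?_
    simp
  refine Summable.of_nonneg_of_le (fun p => by positivity) (fun p => ?_) h1
  rw [← pow_mul]
  gcongr ?_ * ?_
  refine pow_le_pow_of_le_one (by positivity) (by exact_mod_cast hρ1) ?_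
  rw [yWeight_apply, degree_fin_two]; nlinarith

/-- The series `∑_{b ≥ k} fₐᵦ xᵃ yᵇ⁻ᵏ`, the quotient of `f` in the division by `yᵏ`. -/
def divYPow (k : ℕ) (f : MvPowerSeries (Fin 2) ℂ) : MvPowerSeries (Fin 2) ℂ :=
  fun p => MvPowerSeries.coeff (p + Finsupp.single 1 k) f

theorem coeff_divYPow (k : ℕ) (f : MvPowerSeries (Fin 2) ℂ) (p : Fin 2 →₀ ℕ) :
    MvPowerSeries.coeff p (divYPow k f) = MvPowerSeries.coeff (p + Finsupp.single 1 k) f := rfl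

theorem yWeight_add_single (k : ℕ) (p : Fin 2 →₀ ℕ) :
    yWeight k (p + Finsupp.single 1 k) = yWeight k p + k := by
  simp [yWeight_apply, add_assoc]

theorem weightedNorm_divYPow_le (k : ℕ) (ρ : ENNReal) (f : MvPowerSeries (Fin 2) ℂ) :
    ρ ^ k * weightedNorm (yWeight k) ρ (divYPow k f) ≤ weightedNorm (yWeight k) ρ f := by
  rw [weightedNorm, ← ENNReal.tsum_mul_left]
  refine le_trans (le_of_eq (tsum_congr fun p => ?_))
    (ENNReal.tsum_comp_le_tsum_of_injective (add_left_injective (Finsupp.single 1 k)) _)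
  simp only [coeff_divYPow, yWeight_add_single, pow_add]
  ring

/-- The approximations `0, A(g), A(g - h A(g)), …` with `A = divYPow k` to the solution of
`q = A(g - h q)`. -/
def quotApprox (k : ℕ) (g h : MvPowerSeries (Fin 2) ℂ) : ℕ → MvPowerSeries (Fin 2) ℂ
  | 0 => 0
  | N + 1 => divYPow k (g - h * quotApprox k g h N)

/-- If `h` has only terms of weight greater than `k`, then `u ↦ divYPow k (h u)` raises by one the
weight up to which two series agree. -/
theorem coeff_mul_congr {k N : ℕ} {h u v : MvPowerSeries (Fin 2) ℂ}
    (hh : ∀ p, yWeight k p ≤ k → MvPowerSeries.coeff p h = 0)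
    (huv : ∀ p, yWeight k p < N → MvPowerSeries.coeff p u = MvPowerSeries.coeff p v)
    {p : Fin 2 →₀ ℕ} (hp : yWeight k p < N + 1 + k) :
    MvPowerSeries.coeff p (h * u) = MvPowerSeries.coeff p (h * v) := by
  classical
  rw [MvPowerSeries.coeff_mul, MvPowerSeries.coeff_mul]
  refine Finset.sum_congr rfl fun x hx => ?_
  by_cases hx1 : yWeight k x.1 ≤ k
  · rw [hh _ hx1, zero_mul, zero_mul]
  · rw [huv]
    have := congrArg (yWeight k) (Finset.HasAntidiagonal.mem_antidiagonal.mp hx)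
    rw [map_add] at this
    omega

theorem coeff_quotApprox_of_le {k : ℕ} {g h : MvPowerSeries (Fin 2) ℂ}
    (hh : ∀ p, yWeight k p ≤ k → MvPowerSeries.coeff p h = 0) {N M : ℕ} (hNM : N ≤ M)
    {p : Fin 2 →₀ ℕ} (hp : yWeight k p < N) :
    MvPowerSeries.coeff p (quotApprox k g h M) = MvPowerSeries.coeff p (quotApprox k g h N) := by
  induction N generalizing M p with
  | zero => omega
  | succ N ih =>
    obtain ⟨M, rfl⟩ : ∃ M', M = M' + 1 := ⟨M - 1, by omega⟩
    simp only [quotApprox, coeff_divYPow, map_sub]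
    rw [coeff_mul_congr (N := N) hh (fun p hp => ih (by omega) hp)]
    rw [yWeight_add_single]
    omega

/-- A series `yᵏ + h` with `h` of small norm and of weight greater than `k` divides every series
with a convergent quotient. -/
theorem exists_quot_of_weightedNorm_le {k : ℕ} {g h : MvPowerSeries (Fin 2) ℂ} {ρ : NNReal}
    (hρ : 0 < ρ) (hρ1 : ρ ≤ 1) (hg : weightedNorm (yWeight k) ρ g ≠ ⊤)
    (hh : ∀ p, yWeight k p ≤ k → MvPowerSeries.coeff p h = 0)
    (hh2 : 2 * weightedNorm (yWeight k) ρ h ≤ ρ ^ k) :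
    ∃ q, IsConvergent q ∧ ∀ p : Fin 2 →₀ ℕ, k ≤ p 1 →
      MvPowerSeries.coeff p (g - q * (MvPowerSeries.X 1 ^ k + h)) = 0 := by
  classical
  have hk0 : (ρ : ENNReal) ^ k ≠ 0 := by simp [hρ.ne']
  have hkt : (ρ : ENNReal) ^ k ≠ ⊤ := by finiteness
  -- a bound on the approximations, uniform in `N`, passes to their coefficientwise limit
  have bound : ∀ N, (ρ : ENNReal) ^ k * weightedNorm (yWeight k) ρ (quotApprox k g h N)
      ≤ 2 * weightedNorm (yWeight k) ρ g := by
    intro N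
    induction N with
    | zero => simp [quotApprox, weightedNorm]
    | succ N ih =>
      refine (weightedNorm_divYPow_le _ _ _).trans ?_
      rw [sub_eq_add_neg, two_mul (weightedNorm _ _ _)]
      refine (weightedNorm_add_le _ _ _ _).trans ?_
      gcongr
      rw [weightedNorm_neg]
      refine (weightedNorm_mul_le _ _ _ _).trans ?_
      have h2 : (2 : ENNReal) * (weightedNorm (yWeight k) ρ h *
          weightedNorm (yWeight k) ρ (quotApprox k g h N)) ≤ 2 * weightedNorm (yWeight k) ρ g := by
        rw [← mul_assoc]
        exact (mul_le_mul_left hh2 _).trans ih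
      exact (ENNReal.mul_le_mul_iff_right two_ne_zero (by finiteness)).1 h2
  -- the coefficients of the approximations are eventually constant
  let q : MvPowerSeries (Fin 2) ℂ :=
    fun p => MvPowerSeries.coeff p (quotApprox k g h (yWeight k p + 1))
  have hq : ∀ {p N}, yWeight k p < N →
      MvPowerSeries.coeff p (quotApprox k g h N) = MvPowerSeries.coeff p q := by
    intro p N hN
    exact coeff_quotApprox_of_le hh (by omega) (by omega)
  refine ⟨q, isConvergent_of_weightedNorm_ne_top (k := k) hρ hρ1 ?_, fun p hp => ?_⟩
  · have h1 : (ρ : ENNReal) ^ k * weightedNorm (yWeight k) ρ q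
        ≤ 2 * weightedNorm (yWeight k) ρ g := by
      rw [weightedNorm, ← ENNReal.tsum_mul_left, ENNReal.tsum_eq_iSup_sum]
      refine iSup_le fun s => ?_
      refine le_trans ?_ (bound (s.sup (yWeight k) + 1))
      rw [weightedNorm, ← ENNReal.tsum_mul_left]
      refine le_trans (le_of_eq (Finset.sum_congr rfl fun p hp => ?_)) (ENNReal.sum_le_tsum s)
      rw [hq (Nat.lt_succ_of_le (Finset.le_sup hp))]
    intro htop
    rw [htop, ENNReal.mul_top hk0, top_le_iff] at h1
    exact ENNReal.mul_ne_top (by finiteness) hg h1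
  · obtain ⟨p, rfl⟩ : ∃ p', p = p' + Finsupp.single 1 k :=
      ⟨p - Finsupp.single 1 k, by
        rw [tsub_add_cancel_of_le]; simpa using hp⟩
    have h1 : MvPowerSeries.coeff p q =
        MvPowerSeries.coeff (p + Finsupp.single 1 k) (g - h * q) := by
      rw [← hq (p := p) (N := yWeight k p + 1 + 1) (by omega)]
      rw [quotApprox, coeff_divYPow, map_sub, map_sub]
      rw [coeff_mul_congr (N := yWeight k p + 1) (v := q) hh (fun p hp => hq hp)]
      rw [yWeight_add_single]; omega
    have h2 : MvPowerSeries.coeff (p + Finsupp.single 1 k) (q * MvPowerSeries.X 1 ^ k)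
        = MvPowerSeries.coeff p q := by
      rw [MvPowerSeries.X_pow_eq, MvPowerSeries.coeff_add_mul_monomial, mul_one]
    rw [mul_add, mul_comm q h, ← sub_sub, sub_right_comm, map_sub, h2, h1, sub_self]

theorem weightedNorm_mul_le_of_weight_gt {k : ℕ} {h : MvPowerSeries (Fin 2) ℂ}
    (hh : ∀ p, yWeight k p ≤ k → MvPowerSeries.coeff p h = 0) (ρ : ENNReal) {ε : ENNReal}
    (hε : ε ≤ 1) :
    weightedNorm (yWeight k) (ε * ρ) h ≤ ε ^ (k + 1) * weightedNorm (yWeight k) ρ h := by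
  rw [weightedNorm, weightedNorm, ← ENNReal.tsum_mul_left]
  refine ENNReal.tsum_le_tsum fun p => ?_
  by_cases hp : yWeight k p ≤ k
  · simp [hh p hp]
  · rw [mul_pow, mul_left_comm]
    gcongr ?_ * _
    exact pow_le_pow_of_le_one zero_le hε (by omega)

/-- Weierstrass division: if `h(0, y)` has order `k` then every convergent `g` is congruent modulo
`h` to a series of degree less than `k` in `y`. -/
theorem exists_weierstrass_division {k : ℕ} (g h : O 2)
    (hlt : ∀ j < k, MvPowerSeries.coeff (Finsupp.single 1 j) h.1 = 0)
    (hk : MvPowerSeries.coeff (Finsupp.single 1 k) h.1 ≠ 0) :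
    ∃ q : O 2, ∀ p : Fin 2 →₀ ℕ, k ≤ p 1 → MvPowerSeries.coeff p (g - q * h).1 = 0 := by
  classical
  set c := MvPowerSeries.coeff (Finsupp.single 1 k) h.1 with hc
  let h' : O 2 := c⁻¹ • h - X 1 ^ k
  have hX : (X 1 ^ k : O 2).1 = MvPowerSeries.X 1 ^ k := rfl
  have hh : ∀ p, yWeight k p ≤ k → MvPowerSeries.coeff p h'.1 = 0 := by
    intro p hp
    have hp0 : p 0 = 0 := by
      rw [yWeight_apply] at hp
      by_contra h0
      have : k + 1 ≤ (k + 1) * p 0 := Nat.le_mul_of_pos_right _ (Nat.pos_of_ne_zero h0)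
      omega
    have hp1 : p = Finsupp.single 1 (p 1) := by
      ext i; fin_cases i <;> simp [hp0]
    have h2 : p 1 ≤ k := by rw [yWeight_apply] at hp; omega
    change MvPowerSeries.coeff p (c⁻¹ • h.1 - MvPowerSeries.X 1 ^ k) = 0
    rw [map_sub, MvPowerSeries.coeff_X_pow, MvPowerSeries.coeff_smul]
    rcases h2.lt_or_eq with h2 | h2
    · rw [if_neg, hp1, hlt _ h2]
      · simp
      · intro h3
        have := DFunLike.congr_fun h3 1
        simp at this; omega
    · rw [if_pos (by rw [hp1, h2]), hp1, h2, ← hc, inv_mul_cancel₀ hk, sub_self]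
  obtain ⟨ρ, hρ, hρ1, hg, hfin⟩ := IsConvergent.exists_weightedNorm_ne_top g.2 h'.2 k
  obtain ⟨C, hC⟩ : ∃ C : NNReal, (C : ENNReal) = weightedNorm (yWeight k) ρ h'.1 :=
    ⟨_, ENNReal.coe_toNNReal hfin⟩
  -- shrinking `ρ` to `ερ` gains a factor `ε` in the comparison of `‖h'‖` with `‖yᵏ‖`
  let ε : NNReal := min 1 (ρ ^ k / (2 * C + 1))
  have hε : 0 < ε := by positivity
  have hε1 : ε ≤ 1 := min_le_left _ _
  have hε2 : 2 * (ε * C) ≤ ρ ^ k := by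
    have h1 : ε * (2 * C + 1) ≤ ρ ^ k := by
      rw [← le_div_iff₀ (by positivity)]; exact min_le_right _ _
    refine le_trans ?_ h1
    rw [mul_add, mul_left_comm]
    exact le_self_add
  obtain ⟨q, hq, hqp⟩ := exists_quot_of_weightedNorm_le (k := k) (g := g.1) (h := h'.1)
    (ρ := ε * ρ) (by positivity) (mul_le_one' hε1 hρ1)
    (ne_top_of_le_ne_top hg (ENNReal.tsum_le_tsum fun p => by
      gcongr; exact mul_le_of_le_one_left zero_le hε1)) hh (by
      push_cast
      refine (mul_le_mul_right (weightedNorm_mul_le_of_weight_gt hh _ (by exact_mod_cast hε1))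
        _).trans ?_
      rw [← hC]
      norm_cast
      calc 2 * (ε ^ (k + 1) * C) = ε ^ k * (2 * (ε * C)) := by ring
        _ ≤ ε ^ k * ρ ^ k := by gcongr
        _ = (ε * ρ) ^ k := (mul_pow _ _ _).symm)
  refine ⟨c⁻¹ • ⟨q, hq⟩, fun p hp => ?_⟩
  convert hqp p hp using 2
  change g.1 - (c⁻¹ • q) * h.1 =
    g.1 - q * (MvPowerSeries.X 1 ^ k + (c⁻¹ • h.1 - MvPowerSeries.X 1 ^ k))
  rw [add_sub_cancel, smul_mul_assoc, mul_smul_comm]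

/-! ### The ring of convergent power series in two variables -/

instance : IsDomain (O 2) :=
  have : IsDomain (MvPowerSeries (Fin 2) ℂ) := NoZeroDivisors.to_isDomain _
  Function.Injective.isDomain (convergentPowerSeries 2).val.toRingHom Subtype.val_injective

/-- The value at the origin of a convergent power series. -/
def constCoeff : O 2 →+* ℂ :=
  MvPowerSeries.constantCoeff.comp (convergentPowerSeries 2).val.toRingHom

theorem constCoeff_eq_coeff (g : O 2) : constCoeff g = MvPowerSeries.coeff 0 g.1 := rfl

@[simp] theorem constCoeff_X (i : Fin 2) : constCoeff (X i) = 0 :=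
  MvPowerSeries.constantCoeff_X i

@[simp] theorem constCoeff_algebraMap (c : ℂ) : constCoeff (algebraMap ℂ (O 2) c) = c := by
  change MvPowerSeries.constantCoeff (algebraMap ℂ (MvPowerSeries (Fin 2) ℂ) c) = c
  rw [MvPowerSeries.algebraMap_apply]
  exact MvPowerSeries.constantCoeff_C c

@[simp] theorem constCoeff_smul (c : ℂ) (g : O 2) : constCoeff (c • g) = c * constCoeff g := by
  rw [Algebra.smul_def, map_mul, constCoeff_algebraMap]

theorem coeff_X_mul_val (i : Fin 2) (p : Fin 2 →₀ ℕ) (a : MvPowerSeries (Fin 2) ℂ) :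
    MvPowerSeries.coeff (Finsupp.single i 1 + p) (MvPowerSeries.X i * a)
      = MvPowerSeries.coeff p a := by
  simpa [MvPowerSeries.X] using
    MvPowerSeries.coeff_add_monomial_mul (Finsupp.single i 1) p a (1 : ℂ)

theorem coeff_X_mul (i : Fin 2) (p : Fin 2 →₀ ℕ) (a : O 2) :
    MvPowerSeries.coeff (p + Finsupp.single i 1) (X i * a).1 = MvPowerSeries.coeff p a.1 := by
  rw [add_comm]
  exact coeff_X_mul_val i p a.1

theorem X_dvd_iff (i : Fin 2) (g : O 2) :
    X i ∣ g ↔ ∀ p : Fin 2 →₀ ℕ, p i = 0 → MvPowerSeries.coeff p g.1 = 0 := by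
  rw [← MvPowerSeries.X_dvd_iff]
  refine ⟨fun ⟨a, ha⟩ => ⟨a.1, by rw [ha]; rfl⟩, fun ⟨a, ha⟩ => ?_⟩
  have hcoeff : ∀ p, MvPowerSeries.coeff p a
      = MvPowerSeries.coeff (p + Finsupp.single i 1) g.1 := by
    intro p
    rw [ha, add_comm]
    exact (coeff_X_mul_val i p a).symm
  obtain ⟨r, hr, hs⟩ := g.2
  refine ⟨⟨a, r, hr, ?_⟩, Subtype.ext ha⟩
  have h1 := (hs.comp_injective (add_left_injective (Finsupp.single i 1))).mul_right r⁻¹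
  refine h1.congr fun p => ?_
  have h5 : (p + Finsupp.single i 1).degree = p.degree + 1 := by simp
  simp only [Function.comp_apply, hcoeff, h5, pow_succ]
  field_simp

theorem eq_single_one_of_apply_zero {p : Fin 2 →₀ ℕ} (hp : p 0 = 0) :
    p = Finsupp.single 1 (p 1) := by
  ext i; fin_cases i <;> simp [hp]

theorem X_zero_dvd_iff (g : O 2) :
    X 0 ∣ g ↔ ∀ k : ℕ, MvPowerSeries.coeff (Finsupp.single 1 k) g.1 = 0 := by
  rw [X_dvd_iff]
  refine ⟨fun h k => h _ (by simp), fun h p hp => ?_⟩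
  rw [eq_single_one_of_apply_zero hp]
  exact h _

theorem X_ne_zero (i : Fin 2) : (X i : O 2) ≠ 0 := fun h => by
  have := congrArg (fun g : O 2 => MvPowerSeries.coeff (Finsupp.single i 1) g.1) h
  simp [X] at this

/-- A convergent power series with nonzero constant term is invertible: this is Weierstrass division
of `1` by a series of order `0`. -/
theorem isUnit_iff (g : O 2) : IsUnit g ↔ constCoeff g ≠ 0 := by
  refine ⟨fun h => (h.map constCoeff).ne_zero, fun h => ?_⟩
  obtain ⟨q, hq⟩ := exists_weierstrass_division (k := 0) 1 g (by simp)
    (by simpa [constCoeff_eq_coeff] using h)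
  have h1 : (1 - q * g).1 = 0 := MvPowerSeries.ext fun p => by simpa using hq p (Nat.zero_le _)
  have h2 : 1 - q * g = 0 := Subtype.ext h1
  exact IsUnit.of_mul_eq_one_right q (sub_eq_zero.1 h2).symm

instance : IsLocalRing (O 2) :=
  IsLocalRing.of_nonunits_add fun a b ha hb => by
    rw [mem_nonunits_iff, isUnit_iff, not_not] at *
    rw [map_add, ha, hb, add_zero]

theorem mem_maximalIdeal_iff (g : O 2) :
    g ∈ IsLocalRing.maximalIdeal (O 2) ↔ constCoeff g = 0 := by
  rw [IsLocalRing.mem_maximalIdeal, mem_nonunits_iff, isUnit_iff, not_not]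

theorem exists_eq_X_mul_add_X_mul {g : O 2} (hg : constCoeff g = 0) :
    ∃ a b : O 2, g = X 0 * a + X 1 * b := by
  -- division by `y` leaves a series in `x` alone
  obtain ⟨b, hb⟩ := exists_weierstrass_division (k := 1) g (X 1)
    (fun j hj => by
      classical
      obtain rfl : j = 0 := by omega
      change MvPowerSeries.coeff _ (MvPowerSeries.X 1) = 0
      simp)
    (by
      classical
      change MvPowerSeries.coeff _ (MvPowerSeries.X 1) ≠ 0
      simp [MvPowerSeries.coeff_X])
  obtain ⟨a, ha⟩ : X 0 ∣ g - b * X 1 := by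
    rw [X_zero_dvd_iff]
    intro k
    rcases k.eq_zero_or_pos with rfl | hk
    · have : constCoeff (g - b * X 1) = 0 := by simp [hg]
      simpa [constCoeff_eq_coeff] using this
    · exact hb _ (by simpa using Nat.succ_le_of_lt hk)
  exact ⟨a, b, by rw [← ha]; ring⟩

theorem mem_maxIdeal_iff (g : O 2) : g ∈ maxIdeal 2 ↔ constCoeff g = 0 := by
  constructor
  · intro h
    have : maxIdeal 2 ≤ RingHom.ker constCoeff := by
      rw [maxIdeal, Ideal.span_le]
      rintro _ ⟨i, rfl⟩
      simp
    exact this h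
  · intro h
    obtain ⟨a, b, rfl⟩ := exists_eq_X_mul_add_X_mul h
    exact add_mem (Ideal.mul_mem_right _ _ (Ideal.subset_span ⟨0, rfl⟩))
      (Ideal.mul_mem_right _ _ (Ideal.subset_span ⟨1, rfl⟩))

theorem maxIdeal_eq_maximalIdeal : maxIdeal 2 = IsLocalRing.maximalIdeal (O 2) := by
  ext g
  rw [mem_maxIdeal_iff, mem_maximalIdeal_iff]

theorem maxIdeal_le_of_X_mem {I : Ideal (O 2)} (h0 : X 0 ∈ I) (h1 : X 1 ∈ I) :
    maxIdeal 2 ≤ I := by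
  rw [maxIdeal, Ideal.span_le]
  rintro _ ⟨i, rfl⟩
  fin_cases i
  exacts [h0, h1]

theorem coeff_eq_zero_of_mem_maxIdeal_pow {j : ℕ} {g : O 2} (hg : g ∈ maxIdeal 2 ^ j)
    {p : Fin 2 →₀ ℕ} (hp : p.degree < j) : MvPowerSeries.coeff p g.1 = 0 := by
  classical
  induction j generalizing g p with
  | zero => omega
  | succ j ih =>
    rw [pow_succ] at hg
    refine Submodule.mul_induction_on hg (fun a ha b hb => ?_) (fun a b ha hb => ?_)
    · change MvPowerSeries.coeff p (a.1 * b.1) = 0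
      rw [MvPowerSeries.coeff_mul]
      refine Finset.sum_eq_zero fun x hx => ?_
      have hx' := congrArg Finsupp.degree (Finset.HasAntidiagonal.mem_antidiagonal.mp hx)
      rw [map_add] at hx'
      by_cases h : x.1.degree < j
      · rw [ih ha h, zero_mul]
      · have : x.2 = 0 := by
          rw [← Finsupp.degree_eq_zero_iff]; omega
        rw [mem_maxIdeal_iff, constCoeff_eq_coeff] at hb
        rw [this, hb, mul_zero]
    · change MvPowerSeries.coeff p (a.1 + b.1) = 0
      rw [map_add, ha, hb, add_zero]

theorem eq_zero_of_forall_mem_maxIdeal_pow {g : O 2} (hg : ∀ j, g ∈ maxIdeal 2 ^ j) : g = 0 :=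
  Subtype.ext <| MvPowerSeries.ext fun p =>
    coeff_eq_zero_of_mem_maxIdeal_pow (hg _) (Nat.lt_succ_self p.degree)

theorem X_mem_maxIdeal (i : Fin 2) : X i ∈ maxIdeal 2 := Ideal.subset_span ⟨i, rfl⟩

theorem eq_zero_of_forall_X_pow_dvd {i : Fin 2} {g : O 2} (hg : ∀ j, X i ^ j ∣ g) : g = 0 :=
  eq_zero_of_forall_mem_maxIdeal_pow fun j =>
    Ideal.mem_of_dvd _ (hg j) (Ideal.pow_mem_pow (X_mem_maxIdeal i) j)

theorem exists_coeff_ne_zero_of_not_X_zero_dvd {g : O 2} (hg : ¬ X 0 ∣ g) :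
    ∃ k, MvPowerSeries.coeff (Finsupp.single 1 k) g.1 ≠ 0 ∧
      ∀ j < k, MvPowerSeries.coeff (Finsupp.single 1 j) g.1 = 0 := by
  classical
  rw [X_zero_dvd_iff] at hg
  push Not at hg
  exact ⟨Nat.find hg, Nat.find_spec hg, fun j hj => not_not.1 (Nat.find_min hg hj)⟩

theorem eq_single_add_single {p : (Fin 2 →₀ ℕ) × (Fin 2 →₀ ℕ)} {n : ℕ}
    (hp : p.1 + p.2 = Finsupp.single 1 n) :
    p.1 = Finsupp.single 1 (p.1 1) ∧ p.2 = Finsupp.single 1 (p.2 1) ∧ p.1 1 + p.2 1 = n := by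
  have h0 := DFunLike.congr_fun hp 0
  have h1 := DFunLike.congr_fun hp 1
  simp at h0 h1
  exact ⟨eq_single_one_of_apply_zero h0.1, eq_single_one_of_apply_zero h0.2, h1⟩

theorem prime_X_zero : Prime (X 0 : O 2) := by
  classical
  refine ⟨X_ne_zero 0, by rw [isUnit_iff]; simp, fun a b hab => ?_⟩
  by_contra! h
  obtain ⟨j, hj, hj'⟩ := exists_coeff_ne_zero_of_not_X_zero_dvd h.1
  obtain ⟨k, hk, hk'⟩ := exists_coeff_ne_zero_of_not_X_zero_dvd h.2
  have h1 := (X_zero_dvd_iff _).1 hab (j + k)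
  change MvPowerSeries.coeff _ (a.1 * b.1) = 0 at h1
  rw [MvPowerSeries.coeff_mul,
    Finset.sum_eq_single (Finsupp.single 1 j, Finsupp.single 1 k)] at h1
  · exact mul_ne_zero hj hk h1
  · intro p hp hne
    obtain ⟨h2, h3, h4⟩ := eq_single_add_single (Finset.HasAntidiagonal.mem_antidiagonal.mp hp)
    by_cases h5 : p.1 1 < j
    · rw [h2, hj' _ h5, zero_mul]
    · by_cases h6 : p.2 1 < k
      · rw [h3, hk' _ h6, mul_zero]
      · refine absurd (Prod.ext ?_ ?_) hne
        · rw [h2]; congr 1; omega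
        · rw [h3]; congr 1; omega
  · intro h2
    exact absurd (Finset.HasAntidiagonal.mem_antidiagonal.mpr (Finsupp.single_add 1 j k).symm) h2

theorem not_X_zero_dvd_X_one : ¬ (X 0 : O 2) ∣ X 1 := fun h => by
  have := (X_zero_dvd_iff _).1 h 1
  simp [X] at this

/-! ### Prime ideals -/

/-- A prime ideal not containing `x` is generated by one of its elements `h` of least order in `y`:
the remainder of a Weierstrass division by `h` is divisible by `x`, and so is its quotient by `x`,
and so on. -/
theorem isPrincipal_of_X_zero_notMem {P : Ideal (O 2)} (hP : P.IsPrime) (hx : X 0 ∉ P) :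
    P.IsPrincipal := by
  classical
  have hdiv : ∀ {g : O 2}, X 0 * g ∈ P → g ∈ P := fun h => (hP.mem_or_mem h).resolve_left hx
  by_cases hex : ∃ k, ∃ h ∈ P, MvPowerSeries.coeff (Finsupp.single 1 k) h.1 ≠ 0
  · obtain ⟨h, hhP, hh⟩ := Nat.find_spec hex
    set k := Nat.find hex
    have hmin : ∀ g ∈ P, ∀ j < k, MvPowerSeries.coeff (Finsupp.single 1 j) g.1 = 0 := by
      intro g hg j hj
      by_contra hne
      exact Nat.find_min hex hj ⟨g, hg, hne⟩
    refine ⟨h, le_antisymm (fun g hg => ?_) ((Ideal.span_singleton_le_iff_mem _).2 hhP)⟩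
    obtain ⟨q, hq⟩ := exists_weierstrass_division g h (hmin h hhP) hh
    have hr : g - q * h ∈ P := P.sub_mem hg (P.mul_mem_left _ hhP)
    have hall : ∀ (j : ℕ) (r : O 2), r ∈ P →
        (∀ p : Fin 2 →₀ ℕ, k ≤ p 1 → MvPowerSeries.coeff p r.1 = 0) → X 0 ^ j ∣ r := by
      intro j
      induction j with
      | zero => simp
      | succ j ih =>
        intro r hr hrk
        obtain ⟨a, rfl⟩ : X 0 ∣ r := by
          rw [X_zero_dvd_iff]
          intro i
          rcases lt_or_ge i k with hi | hi
          · exact hmin r hr i hi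
          · exact hrk _ (by simpa using hi)
        rw [pow_succ']
        refine mul_dvd_mul_left _ (ih a (hdiv hr) fun p hp => ?_)
        rw [← coeff_X_mul 0]
        exact hrk _ (by simpa using hp)
    have h0 := eq_zero_of_forall_X_pow_dvd fun j => hall j _ hr hq
    exact Ideal.mem_span_singleton.2 ⟨q, by rw [sub_eq_zero.1 h0, mul_comm]⟩
  · push Not at hex
    have hall : ∀ (j : ℕ), ∀ g ∈ P, X 0 ^ j ∣ g := by
      intro j
      induction j with
      | zero => simp
      | succ j ih =>
        intro g hg
        obtain ⟨a, rfl⟩ := (X_zero_dvd_iff g).2 fun k => hex k g hg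
        rw [pow_succ']
        exact mul_dvd_mul_left _ (ih a (hdiv hg))
    refine ⟨0, le_antisymm (fun g hg => ?_) (by simp)⟩
    rw [eq_zero_of_forall_X_pow_dvd fun j => hall j g hg]
    exact zero_mem _

/-- If `g` is not divisible by `x` then `⟨x, g⟩` contains a power of `y`, by division of a suitable
power of `y` by `g`. -/
theorem X_one_mem_of_X_zero_mem {P : Ideal (O 2)} (hP : P.IsPrime) (hx : X 0 ∈ P)
    {g : O 2} (hg : g ∈ P) (hgx : ¬ X 0 ∣ g) : X 1 ∈ P := by
  classical
  obtain ⟨k, hk, hlt⟩ := exists_coeff_ne_zero_of_not_X_zero_dvd hgx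
  obtain ⟨q, hq⟩ := exists_weierstrass_division (X 1 ^ k) g hlt hk
  obtain ⟨a, ha⟩ : X 0 ∣ X 1 ^ k - q * g := by
    rw [X_zero_dvd_iff]
    intro i
    rcases lt_or_ge i k with hi | hi
    · change MvPowerSeries.coeff _ (MvPowerSeries.X 1 ^ k - q.1 * g.1) = 0
      rw [map_sub, MvPowerSeries.coeff_X_pow, if_neg, MvPowerSeries.coeff_mul,
        Finset.sum_eq_zero, sub_zero]
      · intro p hp
        obtain ⟨h2, h3, h4⟩ := eq_single_add_single (Finset.HasAntidiagonal.mem_antidiagonal.mp hp)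
        rw [h3, hlt _ (by omega), mul_zero]
      · intro h
        have := DFunLike.congr_fun h 1
        simp at this; omega
    · exact hq _ (by simpa using hi)
  refine hP.mem_of_pow_mem k ?_
  rw [sub_eq_iff_eq_add.1 ha]
  exact add_mem (P.mul_mem_right _ hx) (P.mul_mem_left _ hg)

/-- A prime ideal of `ℂ{x, y}` is principal or maximal. -/
theorem isPrincipal_or_eq_maxIdeal {P : Ideal (O 2)} (hP : P.IsPrime) :
    P.IsPrincipal ∨ P = maxIdeal 2 := by
  by_cases hx : X 0 ∈ P
  · by_cases h : ∃ g ∈ P, ¬ X 0 ∣ g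
    · obtain ⟨g, hg, hgx⟩ := h
      right
      refine le_antisymm ?_ (maxIdeal_le_of_X_mem hx (X_one_mem_of_X_zero_mem hP hx hg hgx))
      rw [maxIdeal_eq_maximalIdeal]
      exact IsLocalRing.le_maximalIdeal hP.ne_top
    · push Not at h
      exact Or.inl ⟨X 0, le_antisymm (fun g hg => Ideal.mem_span_singleton.2 (h g hg))
        ((Ideal.span_singleton_le_iff_mem _).2 hx)⟩
  · exact Or.inl (isPrincipal_of_X_zero_notMem hP hx)

instance : IsNoetherianRing (O 2) := by
  refine IsNoetherianRing.of_prime fun P hP => ?_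
  rcases isPrincipal_or_eq_maxIdeal hP with h | rfl
  · obtain ⟨a, rfl⟩ := h
    exact Submodule.fg_span_singleton a
  · exact Submodule.fg_span (Set.finite_range X)

instance : UniqueFactorizationMonoid (O 2) := by
  refine UniqueFactorizationMonoid.iff_exists_prime_mem_of_isPrime.2 fun P hP0 hP => ?_
  rcases isPrincipal_or_eq_maxIdeal hP with ⟨a, ha⟩ | rfl
  · have ha0 : a ≠ 0 := by rintro rfl; exact hP0 (by simpa using ha)
    exact ⟨a, ha ▸ Submodule.mem_span_singleton_self a,
      (Ideal.span_singleton_prime ha0).1 (by rwa [← Ideal.submodule_span_eq, ← ha])⟩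
  · exact ⟨X 0, X_mem_maxIdeal 0, prime_X_zero⟩

instance : (Ideal.span {(X 0 : O 2)}).IsPrime :=
  (Ideal.span_singleton_prime (X_ne_zero 0)).2 prime_X_zero

/-- The ring `ℂ{x, y} / (x)`, isomorphic to `ℂ{y}`, is a principal ideal domain. -/
instance : IsPrincipalIdealRing (O 2 ⧸ Ideal.span {(X 0 : O 2)}) := by
  refine IsPrincipalIdealRing.of_prime (R := O 2 ⧸ Ideal.span {(X 0 : O 2)}) fun P hP => ?_
  have hsurj := Ideal.Quotient.mk_surjective (I := Ideal.span {(X 0 : O 2)})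
  have hP' : (P.comap (Ideal.Quotient.mk (Ideal.span {(X 0 : O 2)}))).IsPrime :=
    Ideal.comap_isPrime _ _
  rw [← Ideal.map_comap_of_surjective _ hsurj P]
  rcases isPrincipal_or_eq_maxIdeal hP' with ⟨a, ha⟩ | h
  · rw [ha, Ideal.submodule_span_eq, Ideal.map_span, Set.image_singleton]
    exact ⟨_, rfl⟩
  · rw [h, maxIdeal, Ideal.map_span]
    refine ⟨Ideal.Quotient.mk _ (X 1), le_antisymm ?_ ?_⟩
    · rw [Ideal.span_le]
      rintro _ ⟨_, ⟨i, rfl⟩, rfl⟩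
      fin_cases i
      · have : Ideal.Quotient.mk (Ideal.span {(X 0 : O 2)}) (X 0) = 0 :=
          Ideal.Quotient.eq_zero_iff_mem.2 (Ideal.mem_span_singleton_self _)
        simp [this]
      · exact Ideal.mem_span_singleton_self _
    · refine (Ideal.span_singleton_le_iff_mem _).2 ?_
      exact Ideal.subset_span ⟨X 1, ⟨1, rfl⟩, rfl⟩

/-! ### Derivations of the ring of convergent power series -/

theorem partialDer_X (i j : Fin 2) : partialDer i (X j : O 2) = if i = j then 1 else 0 := by
  apply Subtype.ext
  change MvPowerSeries.pderiv ℂ i (MvPowerSeries.X j) = _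
  rw [MvPowerSeries.pderiv_X, Pi.single_apply]
  by_cases h : i = j
  · rw [if_pos h, if_pos h.symm]; rfl
  · rw [if_neg h, if_neg (Ne.symm h)]; rfl

theorem coeff_partialDer (i : Fin 2) (g : O 2) (p : Fin 2 →₀ ℕ) :
    MvPowerSeries.coeff p (partialDer i g).1 =
      MvPowerSeries.coeff (p + Finsupp.single i 1) g.1 * (p i + 1) :=
  MvPowerSeries.coeff_pderiv _ _

/-- A `ℂ`-derivation along a ring homomorphism `γ` into a ring that is Hausdorff for the `γ(𝔪)`-adic
topology is determined by its values on the coordinates. -/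
theorem eq_zero_of_leibniz {A : Type*} [CommRing A] (γ : O 2 →+* A) (I : Ideal A)
    (hI : ∀ z, (∀ n : ℕ, z ∈ I ^ n) → z = 0) (hγ : ∀ i, γ (X i) ∈ I) (D : O 2 →+ A)
    (hc : ∀ c : ℂ, D (algebraMap ℂ (O 2) c) = 0)
    (hmul : ∀ a b, D (a * b) = γ a * D b + γ b * D a) (hX : ∀ i, D (X i) = 0) (g : O 2) :
    D g = 0 := by
  have key : ∀ (n : ℕ) (g : O 2), D g ∈ I ^ n := by
    intro n
    induction n with
    | zero => simp
    | succ n ih =>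
      intro g
      obtain ⟨a, b, hab⟩ := exists_eq_X_mul_add_X_mul
        (g := g - algebraMap ℂ (O 2) (constCoeff g)) (by simp)
      rw [sub_eq_iff_eq_add.1 hab, map_add, map_add, hc, hmul, hmul, hX, hX, mul_zero, mul_zero,
        add_zero, add_zero, add_zero, pow_succ']
      exact add_mem (Ideal.mul_mem_mul (hγ 0) (ih a)) (Ideal.mul_mem_mul (hγ 1) (ih b))
  exact hI _ fun n => key n g

theorem derivation_apply (δ : Derivation ℂ (O 2) (O 2)) (g : O 2) :
    δ g = δ (X 0) * partialDer 0 g + δ (X 1) * partialDer 1 g := by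
  let D : Derivation ℂ (O 2) (O 2) := δ - (δ (X 0) • partialDer 0 + δ (X 1) • partialDer 1)
  have h := eq_zero_of_leibniz (RingHom.id (O 2)) (maxIdeal 2)
    (fun z hz => eq_zero_of_forall_mem_maxIdeal_pow hz) X_mem_maxIdeal
    (D : O 2 →ₗ[ℂ] O 2).toAddMonoidHom (fun c => D.map_algebraMap c)
    (fun a b => D.leibniz a b) (fun i => by
      fin_cases i <;> simp [D, partialDer_X]) g
  exact sub_eq_zero.1 h

theorem derivation_ext {δ δ' : Derivation ℂ (O 2) (O 2)} (h : ∀ i, δ (X i) = δ' (X i)) :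
    δ = δ' := by
  ext1 g
  rw [derivation_apply δ, derivation_apply δ', h, h]

theorem commutator_partialDer_apply (δ : Derivation ℂ (O 2) (O 2)) (i : Fin 2) (g : O 2) :
    partialDer i (δ g) - δ (partialDer i g) =
      partialDer i (δ (X 0)) * partialDer 0 g + partialDer i (δ (X 1)) * partialDer 1 g := by
  have h := derivation_apply ⁅partialDer i, δ⁆ g
  simp only [Derivation.commutator_apply, partialDer_X] at h
  rw [h]
  have h1 : ∀ j, δ (if i = j then (1 : O 2) else 0) = 0 := fun j => by split_ifs <;> simp
  rw [h1, h1, sub_zero, sub_zero]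

/-- The coefficient of `xᵢ` in a convergent power series. -/
def linCoeff (i : Fin 2) (g : O 2) : ℂ := constCoeff (partialDer i g)

theorem linCoeff_eq_coeff (i : Fin 2) (g : O 2) :
    linCoeff i g = MvPowerSeries.coeff (Finsupp.single i 1) g.1 := by
  rw [linCoeff, constCoeff_eq_coeff, coeff_partialDer]
  simp

theorem linCoeff_add (i : Fin 2) (a b : O 2) :
    linCoeff i (a + b) = linCoeff i a + linCoeff i b := by
  simp [linCoeff]

theorem linCoeff_sub (i : Fin 2) (a b : O 2) :
    linCoeff i (a - b) = linCoeff i a - linCoeff i b := by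
  simp [linCoeff]

theorem linCoeff_mul (i : Fin 2) (a b : O 2) :
    linCoeff i (a * b) = constCoeff a * linCoeff i b + constCoeff b * linCoeff i a := by
  simp [linCoeff]

theorem linCoeff_X (i j : Fin 2) : linCoeff i (X j) = if i = j then 1 else 0 := by
  rw [linCoeff, partialDer_X]
  split_ifs <;> simp

theorem linCoeff_smul (i : Fin 2) (c : ℂ) (a : O 2) : linCoeff i (c • a) = c * linCoeff i a := by
  simp [linCoeff]

theorem linCoeff_algebraMap (i : Fin 2) (c : ℂ) : linCoeff i (algebraMap ℂ (O 2) c) = 0 := by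
  simp [linCoeff]

theorem linCoeff_linearComponent (i : Fin 2) (g : O 2) :
    linCoeff i (linearComponent g) = linCoeff i g := by
  rw [linearComponent, Fin.sum_univ_two, linCoeff_add, linCoeff_smul, linCoeff_smul, linCoeff_X,
    linCoeff_X, ← linCoeff_eq_coeff, ← linCoeff_eq_coeff]
  fin_cases i <;> simp

theorem linearComponent_eq_zero {g : O 2} (h : ∀ i, linCoeff i g = 0) : linearComponent g = 0 := by
  refine Finset.sum_eq_zero fun i _ => ?_
  rw [← linCoeff_eq_coeff, h, zero_smul]

theorem linearPart_apply_X (δ : Derivation ℂ (O 2) (O 2)) (j : Fin 2) :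
    linearPart δ (X j) = linearComponent (δ (X j)) := by
  rw [linearPart, Fin.sum_univ_two]
  fin_cases j <;> simp [partialDer_X]

theorem linearPart_eq_zero {δ : Derivation ℂ (O 2) (O 2)} (h : ∀ i j, linCoeff i (δ (X j)) = 0) :
    linearPart δ = 0 := by
  refine Finset.sum_eq_zero fun j _ => ?_
  rw [linearComponent_eq_zero fun i => h i j, zero_smul]

theorem constCoeff_derivation {δ : Derivation ℂ (O 2) (O 2)} (hδ : ∀ j, constCoeff (δ (X j)) = 0)
    (g : O 2) : constCoeff (δ g) = 0 := by
  rw [derivation_apply]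
  simp [hδ]

theorem linCoeff_derivation {δ : Derivation ℂ (O 2) (O 2)} (hδ : ∀ j, constCoeff (δ (X j)) = 0)
    (i : Fin 2) (g : O 2) :
    linCoeff i (δ g) =
      linCoeff i (δ (X 0)) * linCoeff 0 g + linCoeff i (δ (X 1)) * linCoeff 1 g := by
  rw [derivation_apply, linCoeff_add, linCoeff_mul, linCoeff_mul, hδ, hδ]
  simp only [linCoeff]
  ring

/-! ### The Tjurina ideal of a reduced curve -/

/-- A proper principal ideal stable under the partial derivatives is zero: all iterated derivatives
of its elements vanish at the origin. -/
theorem eq_zero_of_dvd_partialDer {p : O 2} (hp : ¬ IsUnit p) (h : ∀ i, p ∣ partialDer i p) :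
    p = 0 := by
  have hstab : ∀ g, p ∣ g → ∀ i, p ∣ partialDer i g := by
    rintro _ ⟨a, rfl⟩ i
    rw [Derivation.leibniz]
    exact dvd_add (Dvd.intro _ rfl) (Dvd.dvd.mul_left (h i) a)
  have key : ∀ (n : ℕ) (q : Fin 2 →₀ ℕ), q.degree = n → ∀ g : O 2, p ∣ g →
      MvPowerSeries.coeff q g.1 = 0 := by
    intro n
    induction n with
    | zero =>
      intro q hq g hg
      rw [Finsupp.degree_eq_zero_iff] at hq
      rw [hq, ← constCoeff_eq_coeff]
      by_contra hne
      exact hp (isUnit_of_dvd_unit hg ((isUnit_iff g).2 hne))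
    | succ n ih =>
      intro q hq g hg
      obtain ⟨i, hi⟩ : ∃ i, q i ≠ 0 := by
        by_contra! hall
        rw [show q = 0 from Finsupp.ext hall] at hq
        simp at hq
      obtain ⟨q, rfl⟩ : ∃ q', q = q' + Finsupp.single i 1 :=
        ⟨q - Finsupp.single i 1, by
          rw [tsub_add_cancel_of_le]; simpa using Nat.one_le_iff_ne_zero.2 hi⟩
      have h1 := ih q (by simpa using hq) _ (hstab g hg i)
      rw [coeff_partialDer] at h1
      exact (mul_eq_zero.1 h1).resolve_right (Nat.cast_add_one_ne_zero _)
  exact Subtype.ext (MvPowerSeries.ext fun q => key _ q rfl p dvd_rfl)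

theorem not_dvd_partialDer_of_squarefree {f p : O 2} (hf : Squarefree f) (hp : Prime p)
    (hpf : p ∣ f) : ¬ ∀ i, p ∣ partialDer i f := by
  intro h
  obtain ⟨q, rfl⟩ := hpf
  have hq : ¬ p ∣ q := fun hq => hp.not_isUnit (hf p (mul_dvd_mul_left p hq))
  refine hp.ne_zero (eq_zero_of_dvd_partialDer hp.not_isUnit fun i => ?_)
  have h1 := h i
  rw [Derivation.leibniz, smul_eq_mul, smul_eq_mul, dvd_add_right (Dvd.intro _ rfl)] at h1
  exact (hp.dvd_or_dvd h1).resolve_left hq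

/-- The Tjurina ideal `⟨f, ∂f/∂x, ∂f/∂y⟩`. -/
def tjurinaIdeal (f : O 2) : Ideal (O 2) := Ideal.span {f, partialDer 0 f, partialDer 1 f}

theorem self_mem_tjurinaIdeal (f : O 2) : f ∈ tjurinaIdeal f := Ideal.subset_span (by simp)

theorem partialDer_mem_tjurinaIdeal (f : O 2) (i : Fin 2) : partialDer i f ∈ tjurinaIdeal f := by
  fin_cases i <;> exact Ideal.subset_span (by simp)

theorem tjurinaIdeal_le {f : O 2} {I : Ideal (O 2)} (h : f ∈ I) (h' : ∀ i, partialDer i f ∈ I) :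
    tjurinaIdeal f ≤ I := by
  rw [tjurinaIdeal, Ideal.span_le]
  rintro _ (rfl | rfl | rfl)
  exacts [h, h' 0, h' 1]

/-- The Tjurina ideal of a reduced curve contains a power of each coordinate: no principal prime
contains it, and the only other nonzero prime ideal is the maximal one. -/
theorem exists_X_pow_mem_tjurinaIdeal {f : O 2} (hf : Squarefree f) (i : Fin 2) :
    ∃ N : ℕ, X i ^ N ∈ tjurinaIdeal f := by
  change X i ∈ (tjurinaIdeal f).radical
  rw [Ideal.radical_eq_sInf, Ideal.mem_sInf]
  rintro P ⟨hJP, hP⟩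
  rcases isPrincipal_or_eq_maxIdeal hP with ⟨p, hp⟩ | rfl
  · have hmem : ∀ g ∈ tjurinaIdeal f, p ∣ g := fun g hg =>
      Ideal.mem_span_singleton.1 (by simpa [hp] using hJP hg)
    have hpf := hmem f (self_mem_tjurinaIdeal f)
    have hp0 : p ≠ 0 := by
      rintro rfl
      exact hf.ne_zero (zero_dvd_iff.1 hpf)
    have hpp : Prime p := (Ideal.span_singleton_prime hp0).1 (by
      rwa [← Ideal.submodule_span_eq, ← hp])
    exact absurd (fun j => hmem _ (partialDer_mem_tjurinaIdeal f j))
      (not_dvd_partialDer_of_squarefree hf hpp hpf)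
  · exact X_mem_maxIdeal i

theorem mem_logDer {f : O 2} {δ : Derivation ℂ (O 2) (O 2)} : δ ∈ logDer f ↔ f ∣ δ f :=
  Ideal.mem_span_singleton

/-- The Tjurina ideal of `f` is stable under `Der_f`. -/
theorem derivation_mem_tjurinaIdeal {f : O 2} {δ : Derivation ℂ (O 2) (O 2)} (hδ : δ ∈ logDer f)
    {g : O 2} (hg : g ∈ tjurinaIdeal f) : δ g ∈ tjurinaIdeal f := by
  obtain ⟨h, hh⟩ := mem_logDer.1 hδ
  have hf := self_mem_tjurinaIdeal f
  have hd := partialDer_mem_tjurinaIdeal f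
  induction hg using Submodule.span_induction with
  | mem g hg =>
    have hd' : ∀ i, δ (partialDer i f) ∈ tjurinaIdeal f := by
      intro i
      rw [← sub_sub_cancel (partialDer i (δ f)) (δ (partialDer i f)),
        commutator_partialDer_apply, hh, Derivation.leibniz]
      refine sub_mem (add_mem ?_ ?_) (add_mem ?_ ?_)
      · exact Ideal.mul_mem_right _ _ hf
      all_goals exact Ideal.mul_mem_left _ _ (hd _)
    rcases hg with rfl | rfl | rfl
    · rw [hh]; exact Ideal.mul_mem_right _ _ hf
    · exact hd' 0
    · exact hd' 1
  | zero => simp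
  | add a b _ _ ha hb => rw [map_add]; exact add_mem ha hb
  | smul a b hb' hb =>
    rw [smul_eq_mul, Derivation.leibniz]
    exact add_mem (Ideal.mul_mem_left _ _ hb) (Ideal.mul_mem_right _ _ hb')

theorem tjurinaIdeal_le_maxIdeal {f : O 2} (hf : f ∈ maxIdeal 2 ^ 3) :
    tjurinaIdeal f ≤ maxIdeal 2 := by
  refine tjurinaIdeal_le (Ideal.pow_le_self (by norm_num) hf) fun i => ?_
  rw [mem_maxIdeal_iff]
  change linCoeff i f = 0
  rw [linCoeff_eq_coeff]
  exact coeff_eq_zero_of_mem_maxIdeal_pow hf (by simp)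

/-- Logarithmic derivations of a reduced singular curve vanish at the origin: otherwise some
`δ(xᵢ)` is a unit, and applying `δ` to the least power of `xᵢ` in the Tjurina ideal, which is stable
under `δ`, yields a smaller one. -/
theorem constCoeff_eq_zero_of_mem_logDer {f : O 2} (hf : Squarefree f)
    (hJ : tjurinaIdeal f ≤ maxIdeal 2) {δ : Derivation ℂ (O 2) (O 2)} (hδ : δ ∈ logDer f)
    (i : Fin 2) : constCoeff (δ (X i)) = 0 := by
  classical
  by_contra hne
  have hex := exists_X_pow_mem_tjurinaIdeal hf i
  have hN := Nat.find_spec hex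
  have hmin := @Nat.find_min _ _ hex
  generalize Nat.find hex = N at hN hmin
  rcases N with _ | N
  · have := (mem_maxIdeal_iff _).1 (hJ hN)
    simp at this
  · have h1 := derivation_mem_tjurinaIdeal hδ hN
    rw [Derivation.leibniz_pow, Nat.add_sub_cancel] at h1
    have hu : IsUnit (algebraMap ℂ (O 2) ((N + 1 : ℕ) : ℂ) * δ (X i)) := by
      rw [isUnit_iff, map_mul, constCoeff_algebraMap]
      exact mul_ne_zero (Nat.cast_ne_zero.2 N.succ_ne_zero) hne
    refine hmin (Nat.lt_succ_self N) ((Ideal.mul_unit_mem_iff_mem _ hu).1 ?_)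
    convert h1 using 1
    rw [map_natCast, nsmul_eq_mul, smul_eq_mul]
    ring

/-! ### Logarithmic derivations: freeness and determinants -/

open Pointwise in
/-- Let `x` be a prime in the Jacobson radical of a Noetherian domain `R` such that `R / x` is a
principal ideal domain. A submodule `N` of `R²` is free if `N / x N` is torsion-free over
`R / x`. -/
theorem free_of_torsionFree_mod_prime {R : Type*} [CommRing R] [IsDomain R] [IsNoetherianRing R]
    {x : R} (hx : Prime x) (hjac : x ∈ (⊥ : Ideal R).jacobson)
    [IsPrincipalIdealRing (R ⧸ Ideal.span {x})] (N : Submodule R (Fin 2 → R))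
    (hN : ∀ c : R, ¬ x ∣ c → ∀ v ∈ N, ∀ w ∈ N, c • v = x • w → ∃ z ∈ N, v = x • z) :
    Module.Free R N := by
  have hprime : (Ideal.span {x}).IsPrime := (Ideal.span_singleton_prime hx.ne_zero).2 hx
  have : Module.FinitePresentation R N := Module.finitePresentation_of_finite _ _
  rw [← Module.free_quotSMulTop_iff_free R N hjac]
  · have : Module.IsTorsionFree (R ⧸ Ideal.span {x}) (QuotSMulTop x N) := by
      refine Module.IsTorsionFree.of_smul_eq_zero fun r m h => ?_
      obtain ⟨c, rfl⟩ := Ideal.Quotient.mk_surjective r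
      obtain ⟨v, rfl⟩ := Submodule.Quotient.mk_surjective _ m
      by_cases hc : x ∣ c
      · exact Or.inl (Ideal.Quotient.eq_zero_iff_mem.2 (Ideal.mem_span_singleton.2 hc))
      · right
        have h1 : c • v ∈ x • (⊤ : Submodule R N) :=
          (Submodule.Quotient.mk_eq_zero _).1 h
        obtain ⟨w, -, hw⟩ := (Submodule.mem_smul_pointwise_iff_exists _ _ _).1 h1
        obtain ⟨z, hz, hvz⟩ := hN c hc v v.2 w w.2 (congrArg Subtype.val hw).symm
        rw [Submodule.Quotient.mk_eq_zero, Submodule.mem_smul_pointwise_iff_exists]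
        exact ⟨⟨z, hz⟩, trivial, Subtype.ext hvz.symm⟩
    have : Module.Finite (R ⧸ Ideal.span {x}) (QuotSMulTop x N) :=
      Module.Finite.of_restrictScalars_finite R _ _
    exact Module.free_of_finite_type_torsion_free'
  · exact fun v w h => smul_right_injective N hx.ne_zero h

/-- The module of coefficients `(α, β)` of the logarithmic derivations `α ∂ₓ + β ∂ᵧ` for `f`. -/
def logCoeffs (f : O 2) : Submodule (O 2) (Fin 2 → O 2) where
  carrier := {v | f ∣ v 0 * partialDer 0 f + v 1 * partialDer 1 f}
  add_mem' := fun {v w} hv hw => by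
    have h := dvd_add (show f ∣ _ from hv) (show f ∣ _ from hw)
    simp only [Set.mem_ofPred_eq, Pi.add_apply]
    convert h using 1
    ring
  zero_mem' := by simp
  smul_mem' := fun c v hv => by
    have h := Dvd.dvd.mul_left (show f ∣ _ from hv) c
    simp only [Set.mem_ofPred_eq, Pi.smul_apply, smul_eq_mul]
    convert h using 1
    ring

theorem mem_logCoeffs {f : O 2} {v : Fin 2 → O 2} :
    v ∈ logCoeffs f ↔ f ∣ v 0 * partialDer 0 f + v 1 * partialDer 1 f := Iff.rfl

/-- The derivation `α ∂ₓ + β ∂ᵧ`. -/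
def derivationOfCoeffs (v : Fin 2 → O 2) : Derivation ℂ (O 2) (O 2) :=
  v 0 • partialDer 0 + v 1 • partialDer 1

theorem derivationOfCoeffs_apply (v : Fin 2 → O 2) (g : O 2) :
    derivationOfCoeffs v g = v 0 * partialDer 0 g + v 1 * partialDer 1 g := rfl

@[simp] theorem derivationOfCoeffs_X (v : Fin 2 → O 2) (i : Fin 2) :
    derivationOfCoeffs v (X i) = v i := by
  fin_cases i <;> simp [derivationOfCoeffs_apply, partialDer_X]

theorem derivationOfCoeffs_mem {f : O 2} {v : Fin 2 → O 2} :
    derivationOfCoeffs v ∈ logDer f ↔ v ∈ logCoeffs f := mem_logDer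

/-- A derivation is logarithmic exactly when its coefficients are. -/
def logCoeffsEquiv (f : O 2) : logCoeffs f ≃ₗ[O 2] logDer f where
  toFun v := ⟨derivationOfCoeffs v.1, derivationOfCoeffs_mem.2 v.2⟩
  invFun δ := ⟨fun i => δ.1 (X i), by
    have h := mem_logDer.1 δ.2
    rw [derivation_apply] at h
    exact h⟩
  map_add' v w := Subtype.ext <| derivation_ext fun i => by
    change _ = derivationOfCoeffs v.1 (X i) + derivationOfCoeffs w.1 (X i)
    simp
  map_smul' c v := Subtype.ext <| derivation_ext fun i => by
    change _ = c * derivationOfCoeffs v.1 (X i)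
    simp
  left_inv v := Subtype.ext <| funext fun i => derivationOfCoeffs_X _ _
  right_inv δ := Subtype.ext <| derivation_ext fun i => derivationOfCoeffs_X _ _

theorem free_logCoeffs {f : O 2} (hf : f ≠ 0) : Module.Free (O 2) (logCoeffs f) := by
  refine free_of_torsionFree_mod_prime prime_X_zero ?_ _ fun c hc v hv w hw h => ?_
  · rw [IsLocalRing.jacobson_eq_maximalIdeal _ bot_ne_top, ← maxIdeal_eq_maximalIdeal]
    exact X_mem_maxIdeal 0
  · have hval : ∀ i, c * v i = X 0 * w i := fun i => congrFun h i
    have hdvd : ∀ i, X 0 ∣ v i := fun i =>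
      (prime_X_zero.dvd_or_dvd (Dvd.intro _ (hval i).symm)).resolve_left hc
    choose z hz using hdvd
    refine ⟨z, ?_, funext hz⟩
    obtain ⟨s, hs⟩ := mem_logCoeffs.1 hv
    obtain ⟨t, ht⟩ := mem_logCoeffs.1 hw
    have h2 : c * s = X 0 * t := mul_left_cancel₀ hf (by
      linear_combination (-c) * hs + X 0 * ht + partialDer 0 f * hval 0 + partialDer 1 f * hval 1)
    obtain ⟨r, rfl⟩ := (prime_X_zero.dvd_or_dvd (Dvd.intro _ h2.symm)).resolve_left hc
    refine mem_logCoeffs.2 ⟨r, mul_left_cancel₀ (X_ne_zero 0) ?_⟩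
    rw [hz, hz] at hs
    linear_combination hs

theorem finrank_logCoeffs {f : O 2} (hf : f ≠ 0) : Module.finrank (O 2) (logCoeffs f) = 2 := by
  apply le_antisymm
  · have := LinearMap.finrank_le_finrank_of_injective (f := (logCoeffs f).subtype)
      Subtype.val_injective
    simpa using this
  · have hmem : ∀ v : Fin 2 → O 2, (f • LinearMap.id : (Fin 2 → O 2) →ₗ[O 2] _) v ∈ logCoeffs f :=
      fun v => ⟨v 0 * partialDer 0 f + v 1 * partialDer 1 f, by simp; ring⟩
    have hinj : Function.Injective (LinearMap.codRestrict _ _ hmem) := fun v w h =>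
      smul_right_injective _ hf (congrArg Subtype.val h)
    have := LinearMap.finrank_le_finrank_of_injective hinj
    simpa using this

/-- The module of logarithmic derivations of a plane curve is free of rank two. -/
theorem nonempty_basis_logDer {f : O 2} (hf : f ≠ 0) :
    Nonempty (Module.Basis (Fin 2) (O 2) (logDer f)) :=
  have := free_logCoeffs hf
  ⟨(Module.finBasisOfFinrankEq _ _ (finrank_logCoeffs hf)).map (logCoeffsEquiv f)⟩

theorem smul_mem_logDer (f : O 2) (δ : Derivation ℂ (O 2) (O 2)) : f • δ ∈ logDer f :=
  mem_logDer.2 (Dvd.intro _ rfl)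

/-- The determinant of the coefficients of two derivations. -/
def derDet (δ η : Derivation ℂ (O 2) (O 2)) : O 2 := δ (X 0) * η (X 1) - δ (X 1) * η (X 0)

theorem exists_eq_combination_of_basis {f : O 2} (b : Module.Basis (Fin 2) (O 2) (logDer f))
    {ξ : Derivation ℂ (O 2) (O 2)} (hξ : ξ ∈ logDer f) :
    ∃ r s : O 2, ∀ i, ξ (X i) = r * (b 0).1 (X i) + s * (b 1).1 (X i) := by
  refine ⟨b.repr ⟨ξ, hξ⟩ 0, b.repr ⟨ξ, hξ⟩ 1, fun i => ?_⟩
  have h := congrArg Subtype.val (b.sum_repr ⟨ξ, hξ⟩)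
  rw [Fin.sum_univ_two] at h
  exact (congrArg (fun δ : Derivation ℂ (O 2) (O 2) => δ (X i)) h).symm

theorem derDet_dvd_of_basis {f : O 2} (b : Module.Basis (Fin 2) (O 2) (logDer f))
    {δ η : Derivation ℂ (O 2) (O 2)} (hδ : δ ∈ logDer f) (hη : η ∈ logDer f) :
    derDet (b 0).1 (b 1).1 ∣ derDet δ η := by
  obtain ⟨r, s, h⟩ := exists_eq_combination_of_basis b hδ
  obtain ⟨t, u, h'⟩ := exists_eq_combination_of_basis b hη
  refine ⟨r * u - s * t, ?_⟩
  rw [derDet, derDet, h, h, h', h']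
  ring

/-- Divisibility by `f` may be tested after multiplication by powers of the coprime elements
`x` and `y`. -/
theorem dvd_of_dvd_mul_X_pow {f d : O 2} {N M : ℕ} (hf : f ≠ 0) (hN : f ∣ d * X 0 ^ N)
    (hM : f ∣ d * X 1 ^ M) : f ∣ d := by
  obtain ⟨a, ha⟩ := hN
  obtain ⟨b, hb⟩ := hM
  have h : a * X 1 ^ M = b * X 0 ^ N :=
    mul_left_cancel₀ hf (by linear_combination (-X 1 ^ M) * ha + X 0 ^ N * hb)
  obtain ⟨c, rfl⟩ := prime_X_zero.pow_dvd_of_dvd_mul_right N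
    (fun h => not_X_zero_dvd_X_one (prime_X_zero.dvd_of_dvd_pow h)) (Dvd.intro_left _ h.symm)
  exact ⟨c, mul_right_cancel₀ (pow_ne_zero N (X_ne_zero 0)) (by linear_combination ha)⟩

/-- By Cramer's rule `f` divides the products of the determinant with `f_x` and `f_y`, hence with
every element of the Tjurina ideal, in particular with powers of `x` and `y`. -/
theorem dvd_derDet {f : O 2} (hf : Squarefree f) {δ η : Derivation ℂ (O 2) (O 2)}
    (hδ : δ ∈ logDer f) (hη : η ∈ logDer f) : f ∣ derDet δ η := by
  obtain ⟨u, hu⟩ := mem_logDer.1 hδ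
  obtain ⟨v, hv⟩ := mem_logDer.1 hη
  rw [derivation_apply] at hu hv
  have hle : tjurinaIdeal f ≤ 
      Submodule.comap (LinearMap.mulLeft (O 2) (derDet δ η)) (Ideal.span {f}) := by
    refine tjurinaIdeal_le ?_ fun i => ?_ <;>
      rw [Submodule.mem_comap, Ideal.mem_span_singleton, LinearMap.mulLeft_apply]
    · exact Dvd.intro_left _ rfl
    · fin_cases i
      · exact ⟨u * η (X 1) - v * δ (X 1), by
          simp only [derDet, Fin.zero_eta]; linear_combination η (X 1) * hu - δ (X 1) * hv⟩
      · exact ⟨v * δ (X 0) - u * η (X 0), by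
          simp only [derDet, Fin.mk_one]; linear_combination δ (X 0) * hv - η (X 0) * hu⟩
  obtain ⟨N, hN⟩ := exists_X_pow_mem_tjurinaIdeal hf 0
  obtain ⟨M, hM⟩ := exists_X_pow_mem_tjurinaIdeal hf 1
  exact dvd_of_dvd_mul_X_pow hf.ne_zero (Ideal.mem_span_singleton.1 (hle hN))
    (Ideal.mem_span_singleton.1 (hle hM))

/-- The necessity of Saito's criterion: the determinant of a basis of `Der_f` is a unit multiple
of `f`. -/
theorem exists_unit_derDet_eq {f : O 2} (hf : Squarefree f)
    (b : Module.Basis (Fin 2) (O 2) (logDer f)) :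
    ∃ u : O 2, IsUnit u ∧ derDet (b 0).1 (b 1).1 = f * u := by
  obtain ⟨u, hu⟩ := dvd_derDet hf (b 0).2 (b 1).2
  refine ⟨u, ?_, hu⟩
  have hcancel : ∀ {g : O 2}, f * u ∣ f * g → u ∣ g := fun h =>
    (mul_dvd_mul_iff_left hf.ne_zero).1 h
  -- the Hamiltonian derivation, which annihilates `f`
  let H : Derivation ℂ (O 2) (O 2) := partialDer 0 f • partialDer 1 - partialDer 1 f • partialDer 0
  have hH : H ∈ logDer f := mem_logDer.2 ⟨0, by simp [H, mul_comm]⟩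
  have hdet := fun {δ η} hδ hη => hu ▸ derDet_dvd_of_basis b (δ := δ) (η := η) hδ hη
  have h1 : u ∣ f := hcancel <| by
    simpa [derDet, partialDer_X] using
      hdet (smul_mem_logDer f (partialDer 0)) (smul_mem_logDer f (partialDer 1))
  have h2 : u ∣ partialDer 0 f := hcancel <| by
    simpa [derDet, partialDer_X, H] using hdet (smul_mem_logDer f (partialDer 0)) hH
  have h3 : u ∣ partialDer 1 f := hcancel <| by
    have h := hdet (smul_mem_logDer f (partialDer 1)) hH
    rwa [show derDet (f • partialDer 1) H = f * partialDer 1 f by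
      simp only [derDet, H]; simp [partialDer_X, -neg_mul, -mul_neg]; ring] at h
  by_contra hnu
  have hu0 : u ≠ 0 := by rintro rfl; exact hf.ne_zero (zero_dvd_iff.1 h1)
  obtain ⟨p, hp, hpu⟩ := WfDvdMonoid.exists_irreducible_factor hnu hu0
  refine not_dvd_partialDer_of_squarefree hf hp.prime (hpu.trans h1) fun i => ?_
  fin_cases i
  exacts [hpu.trans h2, hpu.trans h3]

/-! ### Formal curves -/

theorem hasSubst_X_mul (d : Fin 2 → PowerSeries ℂ) :
    MvPowerSeries.HasSubst fun i => (PowerSeries.X * d i : PowerSeries ℂ) :=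
  MvPowerSeries.hasSubst_of_constantCoeff_zero fun i => by
    change PowerSeries.constantCoeff (PowerSeries.X * d i) = 0
    simp

/-- The restriction of convergent power series to the formal curve
`t ↦ (t d₀(t), t d₁(t))` through the origin. -/
def curve (d : Fin 2 → PowerSeries ℂ) : O 2 →ₐ[ℂ] PowerSeries ℂ :=
  (MvPowerSeries.substAlgHom (hasSubst_X_mul d)).comp (convergentPowerSeries 2).val

theorem curve_X (d : Fin 2 → PowerSeries ℂ) (i : Fin 2) : curve d (X i) = PowerSeries.X * d i :=
  MvPowerSeries.substAlgHom_X (hasSubst_X_mul d) i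

theorem X_dvd_curve {d : Fin 2 → PowerSeries ℂ} {g : O 2} (hg : constCoeff g = 0) :
    PowerSeries.X ∣ curve d g := by
  obtain ⟨a, b, rfl⟩ := exists_eq_X_mul_add_X_mul hg
  rw [map_add, map_mul, map_mul, curve_X, curve_X, mul_assoc, mul_assoc, ← mul_add]
  exact Dvd.intro _ rfl

theorem constantCoeff_curve (d : Fin 2 → PowerSeries ℂ) (g : O 2) :
    PowerSeries.constantCoeff (curve d g) = constCoeff g := by
  have h := X_dvd_curve (d := d) (g := g - algebraMap ℂ (O 2) (constCoeff g)) (by simp)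
  rw [PowerSeries.X_dvd_iff, map_sub, map_sub, AlgHom.commutes, sub_eq_zero] at h
  exact h.trans (PowerSeries.constantCoeff_C _)

/-- The chain rule along a formal curve. -/
theorem derivative_curve (d : Fin 2 → PowerSeries ℂ) (g : O 2) :
    PowerSeries.derivative ℂ (curve d g) =
      curve d (partialDer 0 g) * PowerSeries.derivative ℂ (PowerSeries.X * d 0) +
      curve d (partialDer 1 g) * PowerSeries.derivative ℂ (PowerSeries.X * d 1) := by
  let D : O 2 →ₗ[ℂ] PowerSeries ℂ := (PowerSeries.derivative ℂ).toLinearMap ∘ₗ (curve d).toLinearMap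
    - (LinearMap.mulRight ℂ (PowerSeries.derivative ℂ (PowerSeries.X * d 0)) ∘ₗ
        (curve d).toLinearMap ∘ₗ (partialDer 0).toLinearMap
      + LinearMap.mulRight ℂ (PowerSeries.derivative ℂ (PowerSeries.X * d 1)) ∘ₗ
        (curve d).toLinearMap ∘ₗ (partialDer 1).toLinearMap)
  have hD : ∀ g, D g = PowerSeries.derivative ℂ (curve d g) -
      (curve d (partialDer 0 g) * PowerSeries.derivative ℂ (PowerSeries.X * d 0) +
      curve d (partialDer 1 g) * PowerSeries.derivative ℂ (PowerSeries.X * d 1)) := fun _ => rfl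
  have h := eq_zero_of_leibniz (curve d : O 2 →+* PowerSeries ℂ) (Ideal.span {PowerSeries.X})
    (fun z hz => PowerSeries.ext fun n => by
      have := hz (n + 1)
      rw [Ideal.span_singleton_pow, Ideal.mem_span_singleton, PowerSeries.X_pow_dvd_iff] at this
      simpa using this n (Nat.lt_succ_self n))
    (fun i => Ideal.mem_span_singleton.2 (X_dvd_curve (constCoeff_X i)))
    D.toAddMonoidHom
    (fun c => by
      change D _ = 0
      rw [hD, AlgHom.commutes, Derivation.map_algebraMap, Derivation.map_algebraMap,
        Derivation.map_algebraMap]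
      simp)
    (fun a b => by
      change D _ = curve d a * D _ + curve d b * D _
      simp only [hD, map_mul, Derivation.leibniz, map_add, smul_eq_mul]
      ring)
    (fun i => by
      change D _ = 0
      rw [hD, partialDer_X, partialDer_X, curve_X]
      fin_cases i <;> simp) g
  exact sub_eq_zero.1 ((hD g).symm.trans h)

/-- Curves that agree modulo `tⁿ⁺¹` restrict every series to the same element modulo `tⁿ⁺¹`. -/
theorem pow_dvd_curve_sub_curve {d e : Fin 2 → PowerSeries ℂ} {n : ℕ}
    (h : ∀ i, PowerSeries.X ^ n ∣ e i - d i) (g : O 2) :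
    PowerSeries.X ^ (n + 1) ∣ curve e g - curve d g := by
  have key : ∀ k ≤ n + 1, ∀ g, PowerSeries.X ^ k ∣ curve e g - curve d g := by
    intro k
    induction k with
    | zero => simp
    | succ k ih =>
      intro hk g
      obtain ⟨a, b, hab⟩ := exists_eq_X_mul_add_X_mul
        (g := g - algebraMap ℂ (O 2) (constCoeff g)) (by simp)
      rw [sub_eq_iff_eq_add.1 hab]
      simp only [map_add, map_mul, AlgHom.commutes, curve_X]
      obtain ⟨r, hr⟩ := ih (by omega) a
      obtain ⟨s, hs⟩ := ih (by omega) b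
      obtain ⟨p, hp⟩ := (pow_dvd_pow PowerSeries.X (show k ≤ n by omega)).trans (h 0)
      obtain ⟨q, hq⟩ := (pow_dvd_pow PowerSeries.X (show k ≤ n by omega)).trans (h 1)
      refine ⟨e 0 * r + e 1 * s + p * curve d a + q * curve d b, ?_⟩
      linear_combination (PowerSeries.X * e 0) * hr + PowerSeries.X * e 1 * hs +
        PowerSeries.X * curve d a * hp + PowerSeries.X * curve d b * hq
  exact key (n + 1) le_rfl g

/-- The first-order effect of perturbing a formal curve by a monomial. -/
theorem pow_dvd_curve_add_sub (d : Fin 2 → PowerSeries ℂ) (e : Fin 2 → ℂ) (n : ℕ) (g : O 2) :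
    PowerSeries.X ^ (n + 2) ∣
      curve (fun i => d i + PowerSeries.X ^ n * PowerSeries.C (e i)) g - curve d g
        - PowerSeries.X ^ (n + 1) * PowerSeries.C (linCoeff 0 g * e 0 + linCoeff 1 g * e 1) := by
  obtain ⟨a, b, hab⟩ := exists_eq_X_mul_add_X_mul
    (g := g - algebraMap ℂ (O 2) (constCoeff g)) (by simp)
  have hga : linCoeff 0 g = constCoeff a := by
    have := congrArg (linCoeff 0) hab
    simpa [linCoeff_sub, linCoeff_add, linCoeff_mul, linCoeff_X, linCoeff_algebraMap] using this
  have hgb : linCoeff 1 g = constCoeff b := by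
    have := congrArg (linCoeff 1) hab
    simpa [linCoeff_sub, linCoeff_add, linCoeff_mul, linCoeff_X, linCoeff_algebraMap] using this
  rw [hga, hgb, sub_eq_iff_eq_add.1 hab]
  set d' : Fin 2 → PowerSeries ℂ := fun i => d i + PowerSeries.X ^ n * PowerSeries.C (e i) with hd'
  have hdd : ∀ i, PowerSeries.X ^ n ∣ d' i - d i := fun i => by simp [hd']
  obtain ⟨r, hr⟩ := pow_dvd_curve_sub_curve hdd a
  obtain ⟨s, hs⟩ := pow_dvd_curve_sub_curve hdd b
  have hconst : ∀ g : O 2, PowerSeries.X ∣ curve d g - PowerSeries.C (constCoeff g) := fun g => by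
    rw [PowerSeries.X_dvd_iff, map_sub, constantCoeff_curve, PowerSeries.constantCoeff_C, sub_self]
  obtain ⟨p, hp⟩ := hconst a
  obtain ⟨q, hq⟩ := hconst b
  simp only [map_add, map_mul, AlgHom.commutes, curve_X]
  refine ⟨d' 0 * r + d' 1 * s + p * PowerSeries.C (e 0) + q * PowerSeries.C (e 1), ?_⟩
  have h0 : d' 0 = d 0 + PowerSeries.X ^ n * PowerSeries.C (e 0) := rfl
  have h1 : d' 1 = d 1 + PowerSeries.X ^ n * PowerSeries.C (e 1) := rfl
  linear_combination (PowerSeries.X * d' 0) * hr + PowerSeries.X * d' 1 * hs +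
    PowerSeries.X ^ (n + 1) * PowerSeries.C (e 0) * hp +
    PowerSeries.X ^ (n + 1) * PowerSeries.C (e 1) * hq +
    PowerSeries.X * curve d a * h0 + PowerSeries.X * curve d b * h1

theorem coeff_X_mul_derivative (F : PowerSeries ℂ) (k : ℕ) :
    PowerSeries.coeff k (PowerSeries.X * PowerSeries.derivative ℂ F) =
      k * PowerSeries.coeff k F := by
  rcases k with _ | k
  · simp
  · rw [PowerSeries.coeff_succ_X_mul, PowerSeries.coeff_derivative]
    push_cast
    ring

theorem coeff_mul_of_pow_dvd {A : PowerSeries ℂ} {k : ℕ} (hA : PowerSeries.X ^ k ∣ A)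
    (G : PowerSeries ℂ) :
    PowerSeries.coeff k (G * A) = PowerSeries.constantCoeff G * PowerSeries.coeff k A := by
  obtain ⟨φ, rfl⟩ := hA
  rw [mul_left_comm]
  simp [PowerSeries.coeff_X_pow_mul']

theorem pow_succ_dvd {A : PowerSeries ℂ} {k : ℕ} (hA : PowerSeries.X ^ k ∣ A)
    (h : PowerSeries.coeff k A = 0) : PowerSeries.X ^ (k + 1) ∣ A := by
  rw [PowerSeries.X_pow_dvd_iff] at hA ⊢
  intro m hm
  rcases Nat.lt_succ_iff_lt_or_eq.1 hm with hm | rfl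
  exacts [hA m hm, h]

/-- The curve given by `d` is an integral curve of `δ` in logarithmic time up to order `n`: the
vector fields `t d/dt` and `δ` agree along it modulo `tⁿ`. -/
def IsIntegralModulo (δ : Derivation ℂ (O 2) (O 2)) (n : ℕ) (d : Fin 2 → PowerSeries ℂ) : Prop :=
  ∀ j, PowerSeries.X ^ n ∣
    PowerSeries.X * PowerSeries.derivative ℂ (PowerSeries.X * d j) - curve d (δ (X j))

/-- If the linear part of `δ` is `ℓ ∂ᵥ` with `ℓ(v) = 1`, so that its eigenvalues are `1` and `0`,
then there are integral curves of `δ` tangent to `v` up to any order: at each order `n ≥ 2` the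
correction is the solution of a linear equation with matrix `n - v ⊗ ℓ`. -/
theorem exists_isIntegralModulo {δ : Derivation ℂ (O 2) (O 2)} {v l : Fin 2 → ℂ}
    (hδ : ∀ j, constCoeff (δ (X j)) = 0) (hlin : ∀ i j, linCoeff i (δ (X j)) = l i * v j)
    (hlv : l 0 * v 0 + l 1 * v 1 = 1) (n : ℕ) :
    ∃ d, (∀ j, PowerSeries.constantCoeff (d j) = v j) ∧ IsIntegralModulo δ (n + 2) d := by
  induction n with
  | zero =>
    refine ⟨fun j => PowerSeries.C (v j), fun j => PowerSeries.constantCoeff_C _, fun j => ?_⟩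
    obtain ⟨r, hr⟩ := pow_dvd_curve_add_sub 0 v 0 (δ (X j))
    have h0 : curve 0 (δ (X j)) = 0 := by
      obtain ⟨a, b, hab⟩ := exists_eq_X_mul_add_X_mul (hδ j)
      rw [hab, map_add, map_mul, map_mul, curve_X, curve_X]
      simp
    rw [h0, hlin, hlin] at hr
    have h1 : l 0 * v j * v 0 + l 1 * v j * v 1 = v j := by linear_combination v j * hlv
    rw [h1] at hr
    simp only [Pi.zero_apply, zero_add, pow_zero, one_mul] at hr
    refine ⟨-r, ?_⟩
    have h2 : PowerSeries.derivative ℂ (PowerSeries.X * PowerSeries.C (v j)) =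
        PowerSeries.C (v j) := by
      rw [Derivation.leibniz, PowerSeries.derivative_C, PowerSeries.derivative_X]
      simp
    rw [h2]
    linear_combination -hr
  | succ n ih =>
    obtain ⟨d, hd, hint⟩ := ih
    choose ρ hρ using hint
    let r : Fin 2 → ℂ := fun j => PowerSeries.constantCoeff (ρ j)
    obtain ⟨s, hs⟩ : ∃ s, s = l 0 * r 0 + l 1 * r 1 := ⟨_, rfl⟩
    have hn1 : (n : ℂ) + 1 ≠ 0 := Nat.cast_add_one_ne_zero n
    have hn2 : (n : ℂ) + 2 ≠ 0 := by exact_mod_cast (Nat.succ_ne_zero (n + 1))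
    -- the solution `e` of `(n + 2) e - ℓ(e) v = -r`
    let e : Fin 2 → ℂ := fun j => -(r j + v j * s / (n + 1)) / (n + 2)
    have hle : l 0 * e 0 + l 1 * e 1 = -s / (n + 1) := by
      simp only [e]
      field_simp
      linear_combination (-s) * hlv + (n + 1) * hs
    have he : ∀ j, r j + (n + 2) * e j - v j * (l 0 * e 0 + l 1 * e 1) = 0 := by
      intro j
      rw [hle]
      simp only [e]
      field_simp
      ring
    refine ⟨fun i => d i + PowerSeries.X ^ (n + 1) * PowerSeries.C (e i), fun j => ?_, fun j => ?_⟩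
    · simp [hd]
    · obtain ⟨w, hw⟩ := pow_dvd_curve_add_sub d e (n + 1) (δ (X j))
      obtain ⟨p, hp⟩ : PowerSeries.X ∣ ρ j - PowerSeries.C (r j) := by
        rw [PowerSeries.X_dvd_iff]; simp [r]
      rw [hlin, hlin] at hw
      have h2 : PowerSeries.derivative ℂ
          (PowerSeries.X * (d j + PowerSeries.X ^ (n + 1) * PowerSeries.C (e j)))
          = PowerSeries.derivative ℂ (PowerSeries.X * d j)
            + PowerSeries.X ^ (n + 1) * PowerSeries.C ((n + 2) * e j) := by
        rw [mul_add, map_add]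
        congr 1
        ext m
        rw [← mul_assoc, ← pow_succ', PowerSeries.coeff_derivative, PowerSeries.coeff_mul_C,
          PowerSeries.coeff_mul_C, PowerSeries.coeff_X_pow, PowerSeries.coeff_X_pow]
        by_cases hm : m = n + 1
        · subst hm; simp; ring
        · simp [hm]
      rw [h2]
      have h3 := congrArg (PowerSeries.C (R := ℂ)) (he j)
      have h4 : PowerSeries.C (l 0 * v j * e 0 + l 1 * v j * e 1)
          = PowerSeries.C (v j * (l 0 * e 0 + l 1 * e 1)) := by congr 1; ring
      rw [h4] at hw
      simp only [map_add, map_sub, map_zero] at h3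
      refine ⟨p - w, ?_⟩
      linear_combination hρ j + PowerSeries.X ^ (n + 2) * hp + PowerSeries.X ^ (n + 2) * h3 - hw

theorem IsIntegralModulo.pow_dvd {δ : Derivation ℂ (O 2) (O 2)} {n : ℕ}
    {d : Fin 2 → PowerSeries ℂ} (h : IsIntegralModulo δ n d) (g : O 2) :
    PowerSeries.X ^ n ∣ PowerSeries.X * PowerSeries.derivative ℂ (curve d g) - curve d (δ g) := by
  obtain ⟨r, hr⟩ := h 0
  obtain ⟨s, hs⟩ := h 1
  refine ⟨curve d (partialDer 0 g) * r + curve d (partialDer 1 g) * s, ?_⟩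
  rw [derivative_curve, derivation_apply δ g, map_add, map_mul (curve d), map_mul (curve d)]
  linear_combination curve d (partialDer 0 g) * hr + curve d (partialDer 1 g) * hs

theorem IsIntegralModulo.coeff_eq {δ : Derivation ℂ (O 2) (O 2)} {n : ℕ}
    {d : Fin 2 → PowerSeries ℂ} (h : IsIntegralModulo δ n d) (g : O 2) {k : ℕ} (hk : k < n) :
    PowerSeries.coeff k (curve d (δ g)) = k * PowerSeries.coeff k (curve d g) := by
  have := PowerSeries.X_pow_dvd_iff.1 (h.pow_dvd g) k hk
  rw [map_sub, coeff_X_mul_derivative, sub_eq_zero] at this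
  exact this.symm

/-- A logarithmic vector field `δ` for `f` with linear part `ℓ ∂ᵥ`, `ℓ(v) = 1`, and `δ(f) = h f`
with `h(0) = 0`: along its integral curve, `f` and its partial derivatives vanish. -/
theorem pow_dvd_curve_partialDer {δ : Derivation ℂ (O 2) (O 2)} {v l : Fin 2 → ℂ} {f h : O 2}
    (hlin : ∀ i j, linCoeff i (δ (X j)) = l i * v j) (hlv : l 0 * v 0 + l 1 * v 1 = 1)
    (hδf : δ f = f * h) (hh : constCoeff h = 0) (hf : constCoeff f = 0)
    (hf' : ∀ i, constCoeff (partialDer i f) = 0) {n : ℕ} {d : Fin 2 → PowerSeries ℂ}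
    (hd : IsIntegralModulo δ n d) :
    PowerSeries.X ^ n ∣ curve d f ∧ ∀ i, PowerSeries.X ^ n ∣ curve d (partialDer i f) := by
  have hF : ∀ k ≤ n, PowerSeries.X ^ k ∣ curve d f := by
    intro k
    induction k with
    | zero => simp
    | succ k ih =>
      intro hk
      have hdvd := ih (by omega)
      refine pow_succ_dvd hdvd ?_
      rcases k.eq_zero_or_pos with rfl | hk0
      · simpa [hf] using constantCoeff_curve d f
      · have h1 := hd.coeff_eq f (k := k) (by omega)
        rw [hδf, mul_comm, map_mul, coeff_mul_of_pow_dvd hdvd, constantCoeff_curve, hh,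
          zero_mul] at h1
        exact (mul_eq_zero.1 h1.symm).resolve_left (by exact_mod_cast hk0.ne')
  have hG : ∀ k ≤ n, ∀ i, PowerSeries.X ^ k ∣ curve d (partialDer i f) := by
    intro k
    induction k with
    | zero => simp
    | succ k ih =>
      intro hk
      have hdvd := ih (by omega)
      have hcoeff : ∀ i, (k : ℂ) * PowerSeries.coeff k (curve d (partialDer i f)) =
          -(l i * (v 0 * PowerSeries.coeff k (curve d (partialDer 0 f)) +
            v 1 * PowerSeries.coeff k (curve d (partialDer 1 f)))) := by
        intro i
        have h1 := hd.coeff_eq (partialDer i f) (k := k) (by omega)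
        have h2 : δ (partialDer i f) = partialDer i h * f + h * partialDer i f
            - partialDer i (δ (X 0)) * partialDer 0 f
            - partialDer i (δ (X 1)) * partialDer 1 f := by
          have h3 := commutator_partialDer_apply δ i f
          rw [hδf, Derivation.leibniz, smul_eq_mul, smul_eq_mul] at h3
          linear_combination -h3
        have hcF := PowerSeries.X_pow_dvd_iff.1 (hF n le_rfl) k (by omega)
        rw [← h1, h2]
        simp only [map_sub, map_add, map_mul]
        rw [coeff_mul_of_pow_dvd (hF k (by omega)), coeff_mul_of_pow_dvd (hdvd i),
          coeff_mul_of_pow_dvd (hdvd 0), coeff_mul_of_pow_dvd (hdvd 1), hcF]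
        simp only [constantCoeff_curve, hh]
        have h4 := hlin i 0
        have h5 := hlin i 1
        rw [linCoeff] at h4 h5
        rw [h4, h5]
        ring
      intro i
      refine pow_succ_dvd (hdvd i) ?_
      rcases k.eq_zero_or_pos with rfl | hk0
      · simpa [hf'] using constantCoeff_curve d (partialDer i f)
      · have h0 := hcoeff 0
        have h1 := hcoeff 1
        have h2 := hcoeff i
        set a := PowerSeries.coeff k (curve d (partialDer 0 f))
        set b := PowerSeries.coeff k (curve d (partialDer 1 f))
        -- the eigenvalues of `v ⊗ ℓ` are `0` and `1`, so `-k` is none of them for `k > 0`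
        have h3 : ((k : ℂ) + 1) * (v 0 * a + v 1 * b) = 0 := by
          linear_combination v 0 * h0 + v 1 * h1 - (v 0 * a + v 1 * b) * hlv
        rw [(mul_eq_zero.1 h3).resolve_left (Nat.cast_add_one_ne_zero k), mul_zero, neg_zero] at h2
        exact (mul_eq_zero.1 h2).resolve_left (by exact_mod_cast hk0.ne')
  exact ⟨hF n le_rfl, hG n le_rfl⟩

/-- A reduced singular curve has no logarithmic vector field `δ` with linear part `ℓ ∂ᵥ`,
`ℓ(v) = 1`, for which `δ(f) / f` vanishes at the origin. -/
theorem constCoeff_ne_zero_of_linCoeff_eq {δ : Derivation ℂ (O 2) (O 2)} {v l : Fin 2 → ℂ}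
    {f h : O 2} (hf : Squarefree f) (hJ : tjurinaIdeal f ≤ maxIdeal 2)
    (hlin : ∀ i j, linCoeff i (δ (X j)) = l i * v j) (hlv : l 0 * v 0 + l 1 * v 1 = 1)
    (hδf : δ f = f * h) : constCoeff h ≠ 0 := by
  intro hh
  have hmem : ∀ g ∈ tjurinaIdeal f, constCoeff g = 0 := fun g hg => (mem_maxIdeal_iff g).1 (hJ hg)
  have hδ := constCoeff_eq_zero_of_mem_logDer hf hJ (mem_logDer.2 (Dvd.intro _ hδf.symm))
  choose N hN using exists_X_pow_mem_tjurinaIdeal hf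
  obtain ⟨d, hdv, hd⟩ := exists_isIntegralModulo hδ hlin hlv (N 0 + N 1)
  obtain ⟨h1, h2⟩ := pow_dvd_curve_partialDer hlin hlv hδf hh (hmem _ (self_mem_tjurinaIdeal f))
    (fun i => hmem _ (partialDer_mem_tjurinaIdeal f i)) hd
  have hle : tjurinaIdeal f ≤
      (Ideal.span {PowerSeries.X ^ (N 0 + N 1 + 2)}).comap (curve d) :=
    tjurinaIdeal_le (Ideal.mem_span_singleton.2 h1) fun i => Ideal.mem_span_singleton.2 (h2 i)
  have hv : ∀ i, v i = 0 := by
    intro i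
    have h3 : PowerSeries.X ^ (N 0 + N 1 + 2) ∣ curve d (X i ^ N i) :=
      Ideal.mem_span_singleton.1 (hle (hN i))
    rw [map_pow, curve_X, mul_pow] at h3
    have h4 : N i < N 0 + N 1 + 2 := by fin_cases i <;> simp <;> omega
    have h5 := PowerSeries.X_pow_dvd_iff.1 h3 (N i) h4
    rw [mul_comm, coeff_mul_of_pow_dvd dvd_rfl, map_pow, hdv, PowerSeries.coeff_X_pow_self,
      mul_one] at h5
    exact eq_zero_of_pow_eq_zero h5
  simp [hv] at hlv

/-! ### Linear parts of a basis of logarithmic derivations -/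

theorem commutator_mem_logDer {f : O 2} {δ η : Derivation ℂ (O 2) (O 2)} (hδ : δ ∈ logDer f)
    (hη : η ∈ logDer f) : ⁅δ, η⁆ ∈ logDer f := by
  obtain ⟨h, hh⟩ := mem_logDer.1 hδ
  obtain ⟨k, hk⟩ := mem_logDer.1 hη
  refine mem_logDer.2 ⟨δ k - η h, ?_⟩
  rw [Derivation.commutator_apply, hh, hk, Derivation.leibniz, Derivation.leibniz, hh, hk]
  simp only [smul_eq_mul]
  ring

/-- If `[δ, η] = r δ + s η` then `δ` multiplies the determinant of `δ` and `η` by `s + div δ`. -/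
theorem derivation_derDet {δ η : Derivation ℂ (O 2) (O 2)} {r s : O 2}
    (h : ∀ j, ⁅δ, η⁆ (X j) = r * δ (X j) + s * η (X j)) :
    δ (derDet δ η) =
      (s + partialDer 0 (δ (X 0)) + partialDer 1 (δ (X 1))) * derDet δ η := by
  have h0 := h 0
  have h1 := h 1
  rw [Derivation.commutator_apply, derivation_apply η (δ (X _))] at h0 h1
  rw [derDet, map_sub, Derivation.leibniz, Derivation.leibniz, derivation_apply δ (δ (X 0)),
    derivation_apply δ (δ (X 1))]
  simp only [smul_eq_mul]
  linear_combination δ (X 0) * h1 - δ (X 1) * h0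

/-- No basis `δ, η` of `Der_f` has linear parts `ℓ ∂ᵥ` and `ℓ' ∂ᵥ` with `ℓ(v) = 1` and `ℓ, ℓ'`
independent. The linear part of `[δ, η]` is `(ℓ'(v) ℓ - ℓ') ∂ᵥ`, so the trace of `[δ, ·]` on `Der_f`
has value `-1` at the origin, which cancels the divergence `ℓ(v) = 1` of `δ`. Hence `δ(f) / f`
vanishes at the origin. -/
theorem false_of_linCoeff_eq {f u : O 2} (hf : Squarefree f) (hJ : tjurinaIdeal f ≤ maxIdeal 2)
    {δ η : Derivation ℂ (O 2) (O 2)} (hδ : δ ∈ logDer f) (hη : η ∈ logDer f)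
    (hdet : derDet δ η = f * u) (hu : IsUnit u)
    (hspan : ∃ r s : O 2, ∀ j, ⁅δ, η⁆ (X j) = r * δ (X j) + s * η (X j)) {v l l' : Fin 2 → ℂ}
    (hδl : ∀ i j, linCoeff i (δ (X j)) = l i * v j)
    (hηl : ∀ i j, linCoeff i (η (X j)) = l' i * v j)
    (hlv : l 0 * v 0 + l 1 * v 1 = 1) (hll : l 0 * l' 1 - l 1 * l' 0 ≠ 0) : False := by
  obtain ⟨r, s, hrs⟩ := hspan
  obtain ⟨h, hh⟩ := mem_logDer.1 hδ
  have hδ0 := constCoeff_eq_zero_of_mem_logDer hf hJ hδ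
  have hη0 := constCoeff_eq_zero_of_mem_logDer hf hJ hη
  refine constCoeff_ne_zero_of_linCoeff_eq hf hJ hδl hlv hh ?_
  -- the linear part of `[δ, η]`, computed in two ways
  have hbr : ∀ i j, v j * ((constCoeff r - (l' 0 * v 0 + l' 1 * v 1)) * l i
      + (constCoeff s + 1) * l' i) = 0 := by
    intro i j
    have h1 := congrArg (linCoeff i) (hrs j)
    rw [Derivation.commutator_apply, linCoeff_sub, linCoeff_derivation hδ0 i (η (X j)),
      linCoeff_derivation hη0 i (δ (X j)), linCoeff_add, linCoeff_mul, linCoeff_mul, hδ0, hη0] at h1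
    simp only [hδl, hηl] at h1
    linear_combination -h1 - l' i * v j * hlv
  obtain ⟨j, hj⟩ : ∃ j, v j ≠ 0 := by
    by_contra! hv
    simp [hv] at hlv
  have hs : constCoeff s + 1 = 0 := by
    have h0 := (mul_eq_zero.1 (hbr 0 j)).resolve_left hj
    have h1 := (mul_eq_zero.1 (hbr 1 j)).resolve_left hj
    refine (mul_eq_zero.1 ?_).resolve_right hll
    linear_combination l 0 * h1 - l 1 * h0
  have h2 := derivation_derDet hrs
  rw [hdet, Derivation.leibniz, hh, smul_eq_mul, smul_eq_mul] at h2
  have h3 : δ u + u * h = (s + partialDer 0 (δ (X 0)) + partialDer 1 (δ (X 1))) * u :=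
    mul_left_cancel₀ hf.ne_zero (by linear_combination h2)
  have h4 := congrArg constCoeff h3
  have h00 : constCoeff (partialDer 0 (δ (X 0))) = l 0 * v 0 := hδl 0 0
  have h11 : constCoeff (partialDer 1 (δ (X 1))) = l 1 * v 1 := hδl 1 1
  simp only [map_add, map_mul, constCoeff_derivation hδ0, h00, h11] at h4
  refine (mul_eq_zero.1 ?_).resolve_left ((isUnit_iff u).1 hu)
  linear_combination h4 + constCoeff u * (hs + hlv)

/-- The case of `not_linCoeff_basis_eq` in which `ℓ(v) ≠ 0`: after scaling, `ℓ(v) = 1`. -/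
theorem linearForm_eq_zero_of_basis {f : O 2} (hf : Squarefree f)
    (hJ : tjurinaIdeal f ≤ maxIdeal 2) (b : Module.Basis (Fin 2) (O 2) (logDer f))
    {v l l' : Fin 2 → ℂ} (hl : ∀ i j, linCoeff i ((b 0).1 (X j)) = l i * v j)
    (hl' : ∀ i j, linCoeff i ((b 1).1 (X j)) = l' i * v j)
    (hll : l 0 * l' 1 - l 1 * l' 0 ≠ 0) : l 0 * v 0 + l 1 * v 1 = 0 := by
  by_contra hp
  set c : ℂ := (l 0 * v 0 + l 1 * v 1)⁻¹ with hc
  have hc0 : c ≠ 0 := inv_ne_zero hp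
  obtain ⟨u, hu, hdet⟩ := exists_unit_derDet_eq hf b
  have hcu : IsUnit (algebraMap ℂ (O 2) c) := (isUnit_iff _).2 (by simpa using hc0)
  have hmem : algebraMap ℂ (O 2) c • (b 0).1 ∈ logDer f := (logDer f).smul_mem _ (b 0).2
  obtain ⟨r, s, hrs⟩ := exists_eq_combination_of_basis b (commutator_mem_logDer hmem (b 1).2)
  refine false_of_linCoeff_eq (u := algebraMap ℂ (O 2) c * u) hf hJ hmem (b 1).2 ?_ (hcu.mul hu)
    ⟨algebraMap ℂ (O 2) c⁻¹ * r, s, fun j => ?_⟩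
    (v := v) (l := fun i => c * l i) (l' := l') (fun i j => ?_) hl' ?_ ?_
  · have h : derDet (algebraMap ℂ (O 2) c • (b 0).1) (b 1).1
        = algebraMap ℂ (O 2) c * derDet (b 0).1 (b 1).1 := by
      simp only [derDet, Derivation.smul_apply, smul_eq_mul]
      ring
    rw [h, hdet]
    ring
  · have hcc : algebraMap ℂ (O 2) c⁻¹ * algebraMap ℂ (O 2) c = 1 := by
      rw [← map_mul, inv_mul_cancel₀ hc0, map_one]
    rw [hrs, Derivation.smul_apply, smul_eq_mul]
    linear_combination (-r * (b 0).1 (X j)) * hcc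
  · rw [Derivation.smul_apply, smul_eq_mul, linCoeff_mul, linCoeff_algebraMap,
      constCoeff_algebraMap, hl]
    ring
  · rw [mul_assoc, mul_assoc, ← mul_add, hc, inv_mul_cancel₀ hp]
  · rw [mul_assoc, mul_assoc, ← mul_sub]
    exact mul_ne_zero hc0 hll

/-- No basis of `Der_f` has linear parts `ℓ ∂ᵥ` and `ℓ' ∂ᵥ` with `ℓ, ℓ'` independent and `v ≠ 0`. -/
theorem not_linCoeff_basis_eq {f : O 2} (hf : Squarefree f) (hJ : tjurinaIdeal f ≤ maxIdeal 2)
    (b : Module.Basis (Fin 2) (O 2) (logDer f)) {v l l' : Fin 2 → ℂ}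
    (hl : ∀ i j, linCoeff i ((b 0).1 (X j)) = l i * v j)
    (hl' : ∀ i j, linCoeff i ((b 1).1 (X j)) = l' i * v j)
    (hll : l 0 * l' 1 - l 1 * l' 0 ≠ 0) : v = 0 := by
  -- both forms vanish at `v`, and they are independent
  have h0 := linearForm_eq_zero_of_basis hf hJ b hl hl' hll
  have h1 := linearForm_eq_zero_of_basis hf hJ (b.reindex (Equiv.swap 0 1)) (v := v) (l := l')
    (l' := l) (by simpa using hl') (by simpa using hl) (fun h => hll (by linear_combination -h))
  ext i
  refine (mul_eq_zero.1 ?_).resolve_left hll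
  fin_cases i
  · simp only [Fin.zero_eta]; linear_combination l' 1 * h0 - l 1 * h1
  · simp only [Fin.mk_one]; linear_combination l 0 * h1 - l' 0 * h0

theorem linCoeff_partialDer_mul {a b : O 2} (ha : constCoeff a = 0) (hb : constCoeff b = 0)
    (i m : Fin 2) : linCoeff i (partialDer m (a * b)) =
      linCoeff i a * linCoeff m b + linCoeff i b * linCoeff m a := by
  rw [Derivation.leibniz, smul_eq_mul, smul_eq_mul, linCoeff_add, linCoeff_mul, linCoeff_mul,
    ha, hb]
  simp only [linCoeff]
  ring

theorem linCoeff_partialDer_eq_zero {g : O 2} (hg : g ∈ maxIdeal 2 ^ 3) (i m : Fin 2) :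
    linCoeff i (partialDer m g) = 0 := by
  rw [linCoeff_eq_coeff, coeff_partialDer, coeff_eq_zero_of_mem_maxIdeal_pow hg (by simp), zero_mul]

/-- Two `2 × 2` matrices `A, B`, regarded as vectors of linear forms (the entry `A i j` is the
coefficient of `xᵢ` in the `j`-th form), whose determinant `A₀ B₁ - A₁ B₀` vanishes: they are
linearly dependent, or their rows are multiples of a common vector `v`. -/
theorem linearForms_of_det_eq_zero {A B : Fin 2 → Fin 2 → ℂ}
    (h : ∀ i m, A i 0 * B m 1 + B i 1 * A m 0 = A i 1 * B m 0 + B i 0 * A m 1) :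
    A = 0 ∨ (∃ c : ℂ, ∀ i j, B i j = c * A i j) ∨
      ∃ v l l' : Fin 2 → ℂ, v ≠ 0 ∧ (∀ i j, A i j = l i * v j) ∧ (∀ i j, B i j = l' i * v j) ∧
        l 0 * l' 1 - l 1 * l' 0 ≠ 0 := by
  have h00 := h 0 0
  have h01 := h 0 1
  have h11 := h 1 1
  by_cases hD : A 0 0 * A 1 1 - A 1 0 * A 0 1 = 0
  · by_cases hA : A = 0
    · exact Or.inl hA
    · obtain ⟨v, l, hl0, hv0, hAl⟩ :
          ∃ v l : Fin 2 → ℂ, l ≠ 0 ∧ v ≠ 0 ∧ ∀ i j, A i j = l i * v j := by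
        obtain ⟨m, k, hmk⟩ : ∃ m k, A m k ≠ 0 := by
          by_contra! hall
          exact hA (funext fun i => funext fun j => hall i j)
        refine ⟨A m, fun i => A i k / A m k, fun hl => ?_, fun hv => hmk (congrFun hv k), ?_⟩
        · exact div_ne_zero hmk hmk (congrFun hl m)
        · intro i j
          rw [div_mul_eq_mul_div, eq_div_iff hmk]
          fin_cases m <;> fin_cases k <;> fin_cases i <;> fin_cases j <;>
            simp only [Fin.zero_eta, Fin.mk_one] <;> grind
      obtain ⟨k, hk⟩ := Function.ne_iff.1 hl0
      obtain ⟨l', hBl⟩ : ∃ l' : Fin 2 → ℂ, ∀ i j, B i j = l' i * v j := by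
        -- `A₀ B₁ - A₁ B₀` is the product of the forms `l` and `v₀ B₁ - v₁ B₀`
        have hw : ∀ i, v 0 * B i 1 - v 1 * B i 0 = 0 := by
          have hlw : ∀ i m, l i * (v 0 * B m 1 - v 1 * B m 0)
              + l m * (v 0 * B i 1 - v 1 * B i 0) = 0 := by
            intro i m
            have him := h i m
            rw [hAl, hAl, hAl, hAl] at him
            linear_combination him
          have hwk : v 0 * B k 1 - v 1 * B k 0 = 0 :=
            (mul_eq_zero.1 (by linear_combination hlw k k / 2)).resolve_left hk
          intro i
          have hik := hlw k i
          rw [hwk, mul_zero, add_zero] at hik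
          exact (mul_eq_zero.1 hik).resolve_left hk
        obtain ⟨j, hj⟩ := Function.ne_iff.1 hv0
        refine ⟨fun i => B i j / v j, fun i m => ?_⟩
        have hwi := hw i
        rw [div_mul_eq_mul_div, eq_div_iff hj]
        fin_cases j <;> fin_cases m <;> simp only [Fin.zero_eta, Fin.mk_one] <;>
          first | rfl | linear_combination hwi | linear_combination -hwi
      by_cases hll : l 0 * l' 1 - l 1 * l' 0 = 0
      · refine Or.inr (Or.inl ⟨l' k / l k, fun i j => ?_⟩)
        have hprop : l' i * l k = l' k * l i := by
          fin_cases i <;> fin_cases k <;> simp only [Fin.zero_eta, Fin.mk_one] <;>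
            first | rfl | linear_combination hll | linear_combination -hll
        rw [hAl, hBl, div_mul_eq_mul_div, eq_div_iff hk]
        linear_combination v j * hprop
      · exact Or.inr (Or.inr ⟨v, l, l', hv0, hAl, hBl, hll⟩)
  · refine Or.inr (Or.inl ⟨(A 0 0 * B 1 1 - A 1 0 * B 0 1) / (A 0 0 * A 1 1 - A 1 0 * A 0 1), ?_⟩)
    -- evaluate the quadratic form and its polar form at the zeros of the two forms in `A`
    have h1 : A 0 0 * B 1 0 - A 1 0 * B 0 0 = 0 := by
      refine (mul_eq_zero.1 ?_).resolve_left hD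
      linear_combination -(A 1 0 ^ 2 / 2) * h00 + A 1 0 * A 0 0 * h01 - A 0 0 ^ 2 / 2 * h11
    have h2 : B 0 1 * A 1 1 - B 1 1 * A 0 1 = 0 := by
      refine (mul_eq_zero.1 ?_).resolve_left hD
      linear_combination A 1 1 ^ 2 / 2 * h00 - A 1 1 * A 0 1 * h01 + A 0 1 ^ 2 / 2 * h11
    have h3 : (B 0 0 * A 1 1 - B 1 0 * A 0 1) - (A 0 0 * B 1 1 - A 1 0 * B 0 1) = 0 := by
      refine (mul_eq_zero.1 ?_).resolve_left hD
      linear_combination A 1 1 * A 1 0 * h00 - (A 1 1 * A 0 0 + A 0 1 * A 1 0) * h01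
        + A 0 1 * A 0 0 * h11
    intro i j
    rw [div_mul_eq_mul_div, eq_div_iff hD]
    fin_cases i <;> fin_cases j <;> simp only [Fin.zero_eta, Fin.mk_one]
    · linear_combination A 0 1 * h1 + A 0 0 * h3
    · linear_combination A 0 0 * h2
    · linear_combination A 1 1 * h1 + A 1 0 * h3
    · linear_combination A 1 0 * h2

/-- The basis `(b₁ + c b₀, b₀)`. -/
theorem exists_basis_add_smul {R M : Type*} [CommRing R] [AddCommMonoid M] [Module R M]
    (b : Module.Basis (Fin 2) R M) (c : R) :
    ∃ b' : Module.Basis (Fin 2) R M, b' 0 = b 1 + c • b 0 := by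
  let e : (Fin 2 → R) ≃ₗ[R] (Fin 2 → R) :=
    { toFun := fun r => ![r 1, r 0 - c * r 1]
      invFun := fun r => ![r 1 + c * r 0, r 0]
      map_add' := fun r s => by ext i; fin_cases i <;> simp; ring
      map_smul' := fun a r => by ext i; fin_cases i <;> simp; ring
      left_inv := fun r => by ext i; fin_cases i <;> simp
      right_inv := fun r => by ext i; fin_cases i <;> simp }
  refine ⟨Module.Basis.ofEquivFun (b.equivFun ≪≫ₗ e), ?_⟩
  rw [Module.Basis.coe_ofEquivFun]
  simp [e, Module.Basis.equivFun_symm_apply, Fin.sum_univ_two, add_comm]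

theorem exists_basis_linearPart_eq_zero {f : O 2} (hf : Squarefree f) (hf3 : f ∈ maxIdeal 2 ^ 3) :
    ∃ δ : Module.Basis (Fin 2) (O 2) (logDer f), linearPart (δ 0).1 = 0 := by
  have hJ := tjurinaIdeal_le_maxIdeal hf3
  obtain ⟨b⟩ := nonempty_basis_logDer hf.ne_zero
  obtain ⟨u, -, hdet⟩ := exists_unit_derDet_eq hf b
  have hdet3 : derDet (b 0).1 (b 1).1 ∈ maxIdeal 2 ^ 3 := hdet ▸ Ideal.mul_mem_right _ _ hf3
  have h0 := fun k => constCoeff_eq_zero_of_mem_logDer hf hJ (b k).2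
  rcases linearForms_of_det_eq_zero (A := fun i j => linCoeff i ((b 0).1 (X j)))
    (B := fun i j => linCoeff i ((b 1).1 (X j))) (fun i m => by
      have h := linCoeff_partialDer_eq_zero hdet3 i m
      rw [derDet, map_sub, linCoeff_sub, linCoeff_partialDer_mul (h0 0 0) (h0 1 1),
        linCoeff_partialDer_mul (h0 0 1) (h0 1 0)] at h
      linear_combination h) with hA | ⟨c, hc⟩ | ⟨v, l, l', hv, hl, hl', hll⟩
  · exact ⟨b, linearPart_eq_zero fun i j => congrFun (congrFun hA i) j⟩
  · obtain ⟨b', hb'⟩ := exists_basis_add_smul b (algebraMap ℂ (O 2) (-c))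
    refine ⟨b', linearPart_eq_zero fun i j => ?_⟩
    have h1 : (b' 0).1 (X j) = (b 1).1 (X j) + (-c) • (b 0).1 (X j) := by
      rw [hb', Algebra.smul_def]; rfl
    rw [h1, linCoeff_add, linCoeff_smul, hc]
    ring
  · exact absurd (not_linCoeff_basis_eq hf hJ b hl hl' hll) hv

theorem not_exists_basis_linearPart_eq {f : O 2} (hf : Squarefree f) (hf3 : f ∈ maxIdeal 2 ^ 3) :
    ¬ ∃ (a : ℂ) (δ : Module.Basis (Fin 2) (O 2) (logDer f)),
      linearPart (δ 0).1 = (X 0 : O 2) • partialDer 0 ∧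
      linearPart (δ 1).1 = (a • X 0 + X 1 : O 2) • partialDer 0 := by
  rintro ⟨a, b, h0, h1⟩
  have key : ∀ {ξ : Derivation ℂ (O 2) (O 2)} {z : O 2}, linearPart ξ = z • partialDer 0 →
      ∀ i j, linCoeff i (ξ (X j)) = linCoeff i z * ![1, 0] j := by
    intro ξ z h i j
    rw [← linCoeff_linearComponent, ← linearPart_apply_X, h, Derivation.smul_apply, partialDer_X]
    fin_cases j <;> simp [linCoeff]
  have hv := not_linCoeff_basis_eq hf (tjurinaIdeal_le_maxIdeal hf3) b (key h0) (key h1) (by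
    simp [linCoeff_add, linCoeff_smul, linCoeff_X])
  simpa using congrFun hv 0

theorem squarefree_map (φ : O 2 ≃ₐ[ℂ] O 2) {f : O 2} (hf : Squarefree f) : Squarefree (φ f) := by
  intro a ha
  have h := map_dvd φ.symm ha
  rw [map_mul, φ.symm_apply_apply] at h
  have h1 := (hf _ h).map φ
  rwa [φ.apply_symm_apply] at h1

theorem map_mem_maxIdeal_pow (φ : O 2 ≃ₐ[ℂ] O 2) {f : O 2} {n : ℕ} (hf : f ∈ maxIdeal 2 ^ n) :
    φ f ∈ maxIdeal 2 ^ n := by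
  have h : (maxIdeal 2).map φ ≤ maxIdeal 2 := by
    rw [Ideal.map_le_iff_le_comap]
    intro g hg
    rw [maxIdeal_eq_maximalIdeal, Ideal.mem_comap, IsLocalRing.mem_maximalIdeal,
      mem_nonunits_iff] at *
    intro hu
    have := hu.map φ.symm
    rw [φ.symm_apply_apply] at this
    exact hg this
  have h1 := Ideal.mem_map_of_mem φ hf
  rw [Ideal.map_pow] at h1
  exact Ideal.pow_right_mono h n h1

end ConvSeries

end

theorem mainTheorem10 (f : ConvSeries.O 2) (hred : Squarefree f)
    (hf : f ∈ ConvSeries.maxIdeal 2 ^ 3) :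
    (∀ φ : ConvSeries.O 2 ≃ₐ[ℂ] ConvSeries.O 2,
      ¬ ∃ (a : ℂ)
          (δ : Module.Basis (Fin 2) (ConvSeries.O 2) (ConvSeries.logDer (φ f))),
        ConvSeries.linearPart (δ 0 : Derivation ℂ (ConvSeries.O 2) (ConvSeries.O 2)) =
          (ConvSeries.X 0 : ConvSeries.O 2) • ConvSeries.partialDer (0 : Fin 2) ∧
        ConvSeries.linearPart (δ 1 : Derivation ℂ (ConvSeries.O 2) (ConvSeries.O 2)) =
          (a • ConvSeries.X 0 + ConvSeries.X 1 : ConvSeries.O 2) •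
            ConvSeries.partialDer (0 : Fin 2)) ∧
    ∃ δ : Module.Basis (Fin 2) (ConvSeries.O 2) (ConvSeries.logDer f),
      ConvSeries.linearPart (δ 0 : Derivation ℂ (ConvSeries.O 2) (ConvSeries.O 2)) = 0 :=
  ⟨fun φ => ConvSeries.not_exists_basis_linearPart_eq (ConvSeries.squarefree_map φ hred)
    (ConvSeries.map_mem_maxIdeal_pow φ hf), ConvSeries.exists_basis_linearPart_eq_zero hred hf⟩
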